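/- Let $H$ be a complex Hilbert space and $V\subseteq H$ a linear subspace. Let $\mathscr C$ be one of the classes $C^\infty$; $C^{k,\alpha}$ with $k\in\mathbb N$, $0<\alpha\le 1$ ($C^k$ with locally $\alpha$-Hölder $k$-th derivative); $C^{\{M\}}$; $C^{(M)}$. Here $M=(M_k)_{k\in\mathbb N}$ is a sequence of positive reals with $M_k^2\le M_{k-1}M_{k+1}$ for $k\ge 1$ and $\sup_{k\ge1}(M_{k+1}/M_k)^{1/k}<\infty$, and in the case of $C^{(M)}$ also $M_k^{1/k}\to\infty$. A $C^\infty$ map $f$ from an open $U\subseteq\mathbb R^q$ to a Banach space is $C^{(M)}$ (resp. $C^{\{M\}}$) if for every compact $K\subseteq U$ and for all (resp. for some) $\rho>0$ the set $\{\|\partial^\beta f(x)\|/(\rho^{|\beta|}\,|\beta|!\,M_{|\beta|}) : x\in K,\ \beta\in\mathbb N^q\}$ is bounded. Let the parameter space $E$ be either $\mathbb R^n$ or, for $\mathscr C=C^\infty$ or $C^{k,\alpha}$, any convenient vector space, that is, a Hausdorff real locally convex space in which a curve $c:\mathbb R\to E$ is $C^\infty$ if and only if $\ell\circ c$ is $C^\infty$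 for all continuous linear functionals $\ell$. On convenient vector spaces "open" and "connected" refer to the $c^\infty$-topology (the final topology with respect to all $C^\infty$ curves), and a map $f$ on a $c^\infty$-open set $U$ is said to be $\mathscr C$ if $f\circ c$ is $\mathscr C$ for every $C^\infty$ curve $c:\mathbb R\to U$. Let $(A(x))_{x\in E}$ be a $\mathscr C$ family of unbounded normal operators in $H$ with common domain $V$: each $A(x)$ is a densely defined closed operator with domain $V$ and $A(x)^*A(x)=A(x)A(x)^*$, and $x\mapsto\langle A(x)u\mid v\rangle$ is $\mathscr C$ on $E$ for all $u\in V$, $v\in H$. Then the global resolvent set $$S=\{(x,z)\in E\times\mathbb C : A(x)-z:V\to H\text{ is bijective}\}$$ is open in $E\times\mathbb C$; for $(x,z)\in S$ the inverse $(A(x)-z)^{-1}$ is a bounded operator on $H$; and the resolvent $S\ni(x,z)\mapsto(A(x)-z)^{-1}\in L(H,H)$ is $\mathscr C$. If moreover every $A(x)$ has compact resolvent (that is, $(A(x)-z)^{-1}$ exists and is compact for some $z\in\mathbb C$), then $S$ is connected (and non-empty). -/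

import Mathlib

open scoped ContDiff NNReal Nat Topology

/-! ### Regularity classes of maps between open sets of coordinate spaces -/

section Classes

variable {ι X F : Type*} [NormedAddCommGroup X] [NormedSpace ℝ X]
  [NormedAddCommGroup F] [NormedSpace ℝ F]

/-- `M` is a sequence of positive reals that is log-convex and stable under derivation:
`sup_k (M_{k+1} / M_k)^{1/k} < ∞` (the entry at `k = 0`, where the exponent is void, is `1`). -/
structure IsWeightSequence (M : ℕ → ℝ) : Prop where
  pos : ∀ k, 0 < M k
  logConvex : ∀ k, M (k + 1) ^ 2 ≤ M k * M (k + 2)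
  stable : BddAbove (Set.range fun k : ℕ => (M (k + 1) / M k) ^ ((1 : ℝ) / (k : ℝ)))

/-- The set of all `∂^β f(x) / (ρ^|β| |β|! M_|β|)`, with `x ∈ K` and `β` any multi-index, is bounded.
The partial derivatives are those in the coordinates given by the basis `b`; the ones of order `k`
are written `∂_{I 0} ⋯ ∂_{I (k-1)} f` with a word `I` of length `k` in the coordinate indices. -/
def DenjoyCarlemanBound (M : ℕ → ℝ) (b : Module.Basis ι ℝ X) (K : Set X) (ρ : ℝ)
    (f : X → F) : Prop :=
  ∃ C : ℝ, ∀ x ∈ K, ∀ (k : ℕ) (I : Fin k → ι),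
    ‖iteratedFDeriv ℝ k f x (fun j => b (I j))‖ ≤ C * (ρ ^ k * (k ! : ℝ) * M k)

/-- The names of the regularity classes `C^∞`, `C^{k,α}`, `C^{(M)}` and `C^{\{M\}}`. -/
inductive RegularityClass where
  | smooth
  | holder (k : ℕ) (α : ℝ≥0)
  | beurling (M : ℕ → ℝ)
  | roumieu (M : ℕ → ℝ)

namespace RegularityClass

/-- The standing assumptions on the parameters of the classes. -/
def Admissible : RegularityClass → Prop
  | smooth => True
  | holder _ α => 0 < α ∧ α ≤ 1
  | beurling M => IsWeightSequence M ∧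
      Filter.Tendsto (fun k : ℕ => M k ^ ((1 : ℝ) / (k : ℝ))) Filter.atTop Filter.atTop
  | roumieu M => IsWeightSequence M

/-- `𝒞.MemOn b U f`: the map `f` is of class `𝒞` on the open set `U` of the space `X`, on which the
basis `b` gives coordinates (these matter only for the Denjoy–Carleman classes). -/
def MemOn (𝒞 : RegularityClass) (b : Module.Basis ι ℝ X) (U : Set X) (f : X → F) : Prop :=
  match 𝒞 with
  | smooth => ContDiffOn ℝ ∞ f U
  | holder k α => ContDiffOn ℝ k f U ∧
      ∀ x ∈ U, ∃ N ∈ 𝓝 x, ∃ C : ℝ≥0, HolderOnWith C α (iteratedFDeriv ℝ k f) N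
  | beurling M => ContDiffOn ℝ ∞ f U ∧
      ∀ K ⊆ U, IsCompact K → ∀ ρ : ℝ, 0 < ρ → DenjoyCarlemanBound M b K ρ f
  | roumieu M => ContDiffOn ℝ ∞ f U ∧
      ∀ K ⊆ U, IsCompact K → ∃ ρ : ℝ, 0 < ρ ∧ DenjoyCarlemanBound M b K ρ f

/-- The class is `C^∞` or some `C^{k,α}`: the classes that are defined on convenient vector spaces
by testing along smooth curves. -/
def IsSmoothOrHolder : RegularityClass → Prop
  | smooth => True
  | holder _ _ => True
  | beurling _ => False
  | roumieu _ => False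

end RegularityClass

end Classes

/-! ### Convenient vector spaces -/

section Convenient

/-- A curve in a topological vector space is `C^∞` if all its iterated derivatives exist. -/
def IsSmoothCurve {X : Type*} [AddCommGroup X] [Module ℝ X] [TopologicalSpace X]
    (c : ℝ → X) : Prop :=
  ∃ d : ℕ → ℝ → X, d 0 = c ∧
    ∀ (k : ℕ) (t : ℝ), Filter.Tendsto (fun s : ℝ => s⁻¹ • (d k (t + s) - d k t))
      (𝓝[≠] 0) (𝓝 (d (k + 1) t))

/-- A (Hausdorff) locally convex space is convenient if every scalarwise `C^∞` curve is `C^∞`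
(the converse holds in every topological vector space). -/
def IsConvenient (X : Type*) [AddCommGroup X] [Module ℝ X] [TopologicalSpace X] : Prop :=
  ∀ c : ℝ → X, IsSmoothCurve c ↔ ∀ l : X →L[ℝ] ℝ, ContDiff ℝ ∞ fun t => l (c t)

/-- The `c^∞`-topology: the final topology with respect to all `C^∞` curves. -/
abbrev cInfTopology (X : Type*) [AddCommGroup X] [Module ℝ X] [TopologicalSpace X] :
    TopologicalSpace X :=
  ⨆ c : {c : ℝ → X // IsSmoothCurve c}, TopologicalSpace.coinduced c.1 inferInstance

/-- `f` is of class `𝒞` (which is `C^∞` or `C^{k,α}`) on the `c^∞`-open set `U` if `f ∘ c` is so for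
every `C^∞` curve `c` in `U`. -/
def RegularityClass.MemOnCurves {X F : Type*} [AddCommGroup X] [Module ℝ X] [TopologicalSpace X]
    [NormedAddCommGroup F] [NormedSpace ℝ F]
    (𝒞 : RegularityClass) (U : Set X) (f : X → F) : Prop :=
  ∀ c : ℝ → X, IsSmoothCurve c → (∀ t, c t ∈ U) →
    𝒞.MemOn (Module.Basis.singleton Unit ℝ) Set.univ fun t => f (c t)

end Convenient

/-! ### Unbounded normal operators and resolvents -/

section Operators

variable {H : Type*} [NormedAddCommGroup H] [InnerProductSpace ℂ H] [CompleteSpace H]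

/-- Unbounded normal operators: densely defined, with closed graph, and `T* T = T T*` (as unbounded
operators, that is, the two compositions have the same graph). -/
structure IsUnboundedNormal (T : H →ₗ.[ℂ] H) : Prop where
  dense : Dense (T.domain : Set H)
  closed : T.IsClosed
  normal : ∀ u w : H,
    (∃ y, (u, y) ∈ T.graph ∧ (y, w) ∈ T.adjoint.graph) ↔
      (∃ y, (u, y) ∈ T.adjoint.graph ∧ (y, w) ∈ T.graph)

variable {V : Submodule ℂ H}

/-- The map `T - z : V → H`. -/
def shifted (T : V →ₗ[ℂ] H) (z : ℂ) : V →ₗ[ℂ] H := T - z • V.subtype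

/-- The bounded operator `R` on `H` is the two-sided inverse of `T - z : V → H`. -/
def IsResolventAt (T : V →ₗ[ℂ] H) (z : ℂ) (R : H →L[ℂ] H) : Prop :=
  (∀ u : V, R (shifted T z u) = u) ∧ ∀ y : H, ∃ u : V, (u : H) = R y ∧ shifted T z u = y

open Classical in
/-- `(T - z)⁻¹ ∈ L(H, H)`, with value `0` where `T - z` has no bounded inverse. -/
noncomputable def resolventOp (T : V →ₗ[ℂ] H) (z : ℂ) : H →L[ℂ] H :=
  if h : ∃ R : H →L[ℂ] H, IsResolventAt T z R then h.choose else 0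

/-- `T` has compact resolvent: `(T - z)⁻¹` exists and is compact for some `z`. -/
def HasCompactResolvent (T : V →ₗ[ℂ] H) : Prop :=
  ∃ (z : ℂ) (R : H →L[ℂ] H), IsResolventAt T z R ∧ IsCompactOperator R

/-- The global resolvent set of a family of operators with common domain `V`. -/
def globalResolventSet {E : Type*} (A : E → V →ₗ[ℂ] H) : Set (E × ℂ) :=
  {p | Function.Bijective (shifted (A p.1) p.2)}

end Operators

/-!
The proof replaces the unbounded operators by bounded ones. The domain `V`, with the graph norm of
one operator of the family, is a Banach space `W`; the inclusion becomes a bounded operator `j : W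
→ H`, and by the closed graph theorem the `A x` become bounded operators `f x : W → H`
(`exists_bounded_model`). Then `(x, z)` lies in the global resolvent set exactly when `f x - z j`
is invertible, and the resolvent there is `j (f x - z j)⁻¹`.

Two facts carry the regularity statement. First, `f` is of class `𝒞` in operator norm because its
matrix coefficients are (`normMemOn_of_matrixCoeff`). This is uniform boundedness: Hölder
quotients, Taylor remainders and Denjoy–Carleman quotients are bounded in norm once they are
bounded for each coefficient, and difference quotients converge since they are Cauchy at a uniform
rate. A Baire argument with a sequence of weights (`exists_opNorm_le_mul_weight`) deals with rates
`ρ` that depend on the coefficient.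

Second, the classes are stable under inversion (`normMemOn_inverse`). For `C^∞` and `C^{k,α}`
inversion is a smooth map. For the Denjoy–Carleman classes one differentiates `R = R(p) + R(p)
(T(p) - T) R`, `R = T⁻¹`, at `p` and gets a convolution inequality for the numbers `‖D^k R(p)‖ /
k!`. It is solved by a geometric sum for `C^{\{M\}}`; for `C^{(M)}` the condition `M_k^{1/k} → ∞`
makes the loss in the rate a factor `2` (`IsWeightSequence.exists_le_of_convolution`).

With compact resolvents the fibres of the global resolvent set over the parameter space are
complements of countable sets in `ℂ`, hence connected. Since projections of open sets are open
along lines, a separation of the global resolvent set would disconnect a line in the parameter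
space (`isConnected_of_countable_compl_fiber`). This only uses that lines are continuous, so it
applies to the `c^∞`-topology as well.
-/

open Filter

/-! ### A uniform boundedness principle with weights -/

section UniformBoundedness

/-- A version of the Banach–Steinhaus theorem in which the bounds `g n i` of a family of operators
`a i` may depend on the operator, and the choice of the weight `g n` may depend on the vector. -/
theorem exists_opNorm_le_mul_weight {𝕜 Y Z ι : Type*} [RCLike 𝕜] [NormedAddCommGroup Y]
    [NormedSpace 𝕜 Y] [CompleteSpace Y] [NormedAddCommGroup Z] [NormedSpace 𝕜 Z]
    (a : ι → Y →L[𝕜] Z) (g : ℕ → ι → ℝ) (hg : ∀ n i, 0 ≤ g n i)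
    (h : ∀ y, ∃ n, ∀ i, ‖a i y‖ ≤ g n i) :
    ∃ (n : ℕ) (C : ℝ), 0 ≤ C ∧ ∀ i, ‖a i‖ ≤ C * g n i := by
  have hclosed : ∀ n, IsClosed {y : Y | ∀ i, ‖a i y‖ ≤ g n i} := by
    intro n
    simp only [Set.ofPred_forall]
    exact isClosed_iInter fun i => isClosed_le (by fun_prop) continuous_const
  obtain ⟨n, y₀, hy₀⟩ := nonempty_interior_of_iUnion_of_closed hclosed
    (Set.eq_univ_of_forall fun y => Set.mem_iUnion.2 (h y))
  obtain ⟨ε, hε, hball⟩ := Metric.isOpen_iff.1 isOpen_interior y₀ hy₀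
  have hmem : ∀ y, ‖y‖ < ε → ∀ i, ‖a i y‖ ≤ 2 * g n i := by
    intro y hy i
    have h1 : ‖a i (y₀ + y)‖ ≤ g n i :=
      interior_subset (hball (by simpa [Metric.mem_ball, dist_eq_norm] using hy)) i
    have h2 : ‖a i y₀‖ ≤ g n i := interior_subset hy₀ i
    have h3 : a i y = a i (y₀ + y) - a i y₀ := by simp
    rw [h3]
    linarith [norm_sub_le (a i (y₀ + y)) (a i y₀)]
  refine ⟨n, 2 / (ε / 2), by positivity, fun i => ?_⟩
  have hg2 : 0 ≤ 2 / (ε / 2) * g n i := mul_nonneg (by positivity) (hg n i)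
  refine (a i).opNorm_le_bound hg2 fun y => ?_
  rcases eq_or_ne y 0 with rfl | hy
  · simp
  have hy' : 0 < ‖y‖ := norm_pos_iff.2 hy
  -- rescale `y` to norm `ε / 2`
  set c : ℝ := ε / 2 / ‖y‖ with hc
  have hc0 : 0 < c := by positivity
  have h1 := hmem ((c : 𝕜) • y) (by
    rw [norm_smul, RCLike.norm_of_nonneg hc0.le, hc, div_mul_cancel₀ _ hy'.ne']
    linarith) i
  rw [map_smul, norm_smul, RCLike.norm_of_nonneg hc0.le, ← le_div_iff₀' hc0] at h1
  refine h1.trans_eq ?_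
  rw [hc]
  field_simp

/-- Uniform boundedness for operators between Hilbert spaces, tested on matrix coefficients. -/
theorem exists_norm_le_mul_weight_of_inner {W H ι : Type*} [NormedAddCommGroup W]
    [NormedSpace ℂ W] [CompleteSpace W] [NormedAddCommGroup H] [InnerProductSpace ℂ H]
    [CompleteSpace H] (a : ι → W →L[ℂ] H) (g : ℕ → ι → ℝ) (hg : ∀ n i, 0 ≤ g n i)
    (hmono : ∀ i, Monotone fun n => g n i)
    (h : ∀ u v, ∃ (n : ℕ) (C : ℝ), ∀ i, ‖inner ℂ v (a i u)‖ ≤ C * g n i) :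
    ∃ (n : ℕ) (C : ℝ), 0 ≤ C ∧ ∀ i, ‖a i‖ ≤ C * g n i := by
  -- the weight `n * g n` absorbs the constants
  have habs : ∀ (n : ℕ) (C : ℝ), ∃ m : ℕ, ∀ i, C * g n i ≤ m * g m i := by
    intro n C
    obtain ⟨k, hk⟩ := exists_nat_ge C
    refine ⟨max n k, fun i => mul_le_mul ?_ (hmono i (le_max_left _ _)) (hg _ _) (by positivity)⟩
    exact hk.trans (by exact_mod_cast le_max_right n k)
  have hg' : ∀ (n : ℕ) i, 0 ≤ (n : ℝ) * g n i := fun n i => mul_nonneg n.cast_nonneg (hg n i)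
  have key : ∃ (n : ℕ) (C : ℝ), 0 ≤ C ∧ ∀ i, ‖a i‖ ≤ C * ((n : ℝ) * g n i) := by
    refine exists_opNorm_le_mul_weight a _ hg' fun u => ?_
    obtain ⟨n, C, -, hC⟩ := exists_opNorm_le_mul_weight (fun i => innerSL ℂ (a i u)) _ hg'
      fun v => by
      obtain ⟨n, C, hC⟩ := h u v
      obtain ⟨m, hm⟩ := habs n C
      refine ⟨m, fun i => ?_⟩
      rw [innerSL_apply_apply, norm_inner_symm]
      exact (hC i).trans (hm i)
    obtain ⟨m, hm⟩ := habs n (C * n)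
    refine ⟨m, fun i => le_trans ?_ (hm i)⟩
    simpa [mul_assoc] using hC i
  obtain ⟨n, C, h0, hC⟩ := key
  exact ⟨n, C * n, by positivity, fun i => by simpa [mul_assoc] using hC i⟩

end UniformBoundedness

/-! ### Log-convex sequences and convolution recursions -/

namespace IsWeightSequence

variable {M : ℕ → ℝ}

theorem monotone_ratio (hM : IsWeightSequence M) : Monotone fun k => M (k + 1) / M k := by
  refine monotone_nat_of_le_succ fun k => ?_
  rw [div_le_div_iff₀ (hM.pos _) (hM.pos _)]
  linarith [hM.logConvex k, sq (M (k + 1))]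

/-- Log-convexity in integrated form. -/
theorem mul_le_mul_add (hM : IsWeightSequence M) (i j : ℕ) : M i * M j ≤ M 0 * M (i + j) := by
  induction j with
  | zero => simp [mul_comm]
  | succ j ih =>
    have h1 : M (j + 1) = M j * (M (j + 1) / M j) := by field_simp [(hM.pos j).ne']
    have h2 : M (i + j + 1) = M (i + j) * (M (i + j + 1) / M (i + j)) := by
      field_simp [(hM.pos (i + j)).ne']
    have h3 := hM.monotone_ratio (Nat.le_add_left j i)
    have h4 : 0 ≤ M (j + 1) / M j := (div_pos (hM.pos _) (hM.pos _)).le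
    have h5 : 0 ≤ M 0 * M (i + j) := (mul_pos (hM.pos _) (hM.pos _)).le
    rw [← add_assoc, h1, h2, ← mul_assoc, ← mul_assoc]
    exact mul_le_mul ih h3 h4 h5

/-- For the weights of Beurling classes the quotients `M k / M (k + 1)` tend to zero. -/
theorem tendsto_ratio (hM : IsWeightSequence M)
    (hroot : Tendsto (fun k : ℕ => M k ^ ((1 : ℝ) / (k : ℝ))) atTop atTop) :
    Tendsto (fun k => M k / M (k + 1)) atTop (𝓝 0) := by
  have hle : ∀ k, M k ≤ M 0 * (M (k + 1) / M k) ^ k := by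
    intro k
    have : ∀ j ≤ k, M j ≤ M 0 * (M (k + 1) / M k) ^ j := by
      intro j
      induction j with
      | zero => simp
      | succ j ih =>
        intro hj
        have h1 : M (j + 1) = M j * (M (j + 1) / M j) := by field_simp [(hM.pos j).ne']
        rw [h1, pow_succ, ← mul_assoc]
        have h4 : 0 ≤ M (k + 1) / M k := (div_pos (hM.pos _) (hM.pos _)).le
        exact mul_le_mul (ih (by omega)) (hM.monotone_ratio (by omega))
          (div_pos (hM.pos _) (hM.pos _)).le (mul_nonneg (hM.pos 0).le (pow_nonneg h4 _))
    exact this k le_rfl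
  have hbig : Tendsto (fun k => M (k + 1) / M k) atTop atTop := by
    have h1 : Tendsto (fun k : ℕ => M k ^ ((1 : ℝ) / (k : ℝ)) * (max 1 (M 0))⁻¹) atTop atTop :=
      hroot.atTop_mul_const (by positivity)
    refine tendsto_atTop_mono' _ ?_ h1
    filter_upwards [eventually_ge_atTop 1] with k hk
    have hk' : (0 : ℝ) < k := by exact_mod_cast hk
    have hq : 0 ≤ M (k + 1) / M k := (div_pos (hM.pos _) (hM.pos _)).le
    rw [← div_eq_mul_inv, div_le_iff₀ (by positivity)]
    calc M k ^ ((1 : ℝ) / k) ≤ (M 0 * (M (k + 1) / M k) ^ k) ^ ((1 : ℝ) / k) :=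
          Real.rpow_le_rpow (hM.pos k).le (hle k) (by positivity)
      _ = M 0 ^ ((1 : ℝ) / k) * (M (k + 1) / M k) := by
          rw [Real.mul_rpow (hM.pos 0).le (by positivity), one_div,
            Real.pow_rpow_inv_natCast hq (by omega)]
      _ ≤ max 1 (M 0) * (M (k + 1) / M k) := by
          refine mul_le_mul_of_nonneg_right ?_ hq
          calc M 0 ^ ((1 : ℝ) / k) ≤ max 1 (M 0) ^ ((1 : ℝ) / k) :=
                Real.rpow_le_rpow (hM.pos 0).le (le_max_right _ _) (by positivity)
            _ ≤ max 1 (M 0) ^ (1 : ℝ) := by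
                refine Real.rpow_le_rpow_of_exponent_le (le_max_left _ _) ?_
                rw [div_le_one hk']
                exact_mod_cast hk
            _ = _ := Real.rpow_one _
      _ = _ := mul_comm _ _
  exact hbig.inv_tendsto_atTop.congr fun k => by simp

theorem tendsto_div_add (hM : IsWeightSequence M)
    (hroot : Tendsto (fun k : ℕ => M k ^ ((1 : ℝ) / (k : ℝ))) atTop atTop) (i : ℕ) :
    Tendsto (fun k => M k / M (k + (i + 1))) atTop (𝓝 0) := by
  induction i with
  | zero => exact hM.tendsto_ratio hroot
  | succ i ih =>
    have h := ih.mul ((tendsto_add_atTop_iff_nat (i + 1)).2 (hM.tendsto_ratio hroot))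
    rw [zero_mul] at h
    refine h.congr fun k => ?_
    have h1 := (hM.pos (k + (i + 1))).ne'
    have h2 : k + (i + 1 + 1) = k + (i + 1) + 1 := by ring
    rw [h2]
    field_simp

/-- A sequence that satisfies a convolution inequality with coefficients bounded by
`A * ρ ^ i * M i` is itself bounded by a multiple of `σ ^ k * M k`, for a larger `σ`. -/
theorem le_of_convolution (hM : IsWeightSequence M) {A B ρ : ℝ} (hA : 0 ≤ A) (hρ : 0 < ρ)
    {s : ℕ → ℝ} (hs0 : s 0 ≤ B)
    (hrec : ∀ k, s (k + 1) ≤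
      A * ∑ i ∈ Finset.range (k + 1), ρ ^ (i + 1) * M (i + 1) * s (k - i)) (hB : 0 ≤ B) (k : ℕ) :
    s k ≤ B / M 0 * ((ρ * (1 + A * M 0)) ^ k * M k) := by
  induction k using Nat.strong_induction_on with
  | _ k ih =>
    rcases k with _ | k
    · simpa [(hM.pos 0).ne'] using hs0
    set σ := ρ * (1 + A * M 0) with hσ
    have hM0 := hM.pos 0
    have hσ0 : 0 < σ := by positivity
    have hD : 0 ≤ B / M 0 := by positivity
    -- `σ - ρ = A * M 0 * ρ`, so this is the geometric sum for `σ ^ (k + 1) - ρ ^ (k + 1)`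
    have hgeom : A * M 0 * ρ * ∑ i ∈ Finset.range (k + 1), ρ ^ i * σ ^ (k - i) ≤ σ ^ (k + 1) := by
      have h := geom_sum₂_mul ρ σ (k + 1)
      simp only [Nat.add_sub_cancel] at h
      have h2 : A * M 0 * ρ = -(ρ - σ) := by rw [hσ]; ring
      have h3 : 0 ≤ ρ ^ (k + 1) := by positivity
      rw [h2]
      linarith
    calc s (k + 1) ≤ A * ∑ i ∈ Finset.range (k + 1), ρ ^ (i + 1) * M (i + 1) * s (k - i) := hrec k
      _ ≤ A * ∑ i ∈ Finset.range (k + 1),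
            (B / M 0 * M (k + 1) * M 0 * ρ) * (ρ ^ i * σ ^ (k - i)) := by
          refine mul_le_mul_of_nonneg_left (Finset.sum_le_sum fun i hi => ?_) hA
          have hik : i + 1 + (k - i) = k + 1 := by have := Finset.mem_range.1 hi; omega
          have h1 := hM.mul_le_mul_add (i + 1) (k - i)
          rw [hik] at h1
          calc ρ ^ (i + 1) * M (i + 1) * s (k - i)
              ≤ ρ ^ (i + 1) * M (i + 1) * (B / M 0 * (σ ^ (k - i) * M (k - i))) :=
                mul_le_mul_of_nonneg_left (ih _ (by omega))
                  (mul_nonneg (by positivity) (hM.pos _).le)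
            _ = B / M 0 * ρ ^ (i + 1) * σ ^ (k - i) * (M (i + 1) * M (k - i)) := by ring
            _ ≤ B / M 0 * ρ ^ (i + 1) * σ ^ (k - i) * (M 0 * M (k + 1)) :=
                mul_le_mul_of_nonneg_left h1 (by positivity)
            _ = _ := by ring
      _ = B / M 0 * M (k + 1) *
            (A * M 0 * ρ * ∑ i ∈ Finset.range (k + 1), ρ ^ i * σ ^ (k - i)) := by
          rw [← Finset.mul_sum]; ring
      _ ≤ B / M 0 * M (k + 1) * σ ^ (k + 1) :=
          mul_le_mul_of_nonneg_left hgeom (mul_nonneg hD (hM.pos _).le)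
      _ = _ := by ring

/-- The self-convolution of `M k / 2 ^ k`, without the term in which the first index vanishes, is
eventually small relative to `M`: divided by `M (k + 1)` it tends to zero by dominated
convergence. -/
theorem eventually_convolution_le (hM : IsWeightSequence M)
    (hroot : Tendsto (fun k : ℕ => M k ^ ((1 : ℝ) / (k : ℝ))) atTop atTop) (A : ℝ) :
    ∀ᶠ k in atTop, A * ∑ i ∈ Finset.range (k + 1),
      (1 / 2 : ℝ) ^ (i + 1) * (M (i + 1) * M (k - i)) ≤ M (k + 1) := by
  let g : ℕ → ℕ → ℝ := fun k i => if i ≤ k then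
    (1 / 2 : ℝ) ^ (i + 1) * (M (i + 1) * (M (k - i) / M (k + 1))) else 0
  have hlim : Tendsto (fun k => ∑' i, g k i) atTop (𝓝 (∑' _ : ℕ, (0 : ℝ))) := by
    refine tendsto_tsum_of_dominated_convergence
      (bound := fun i => (1 / 2 : ℝ) ^ (i + 1) * M 0) ?_ (fun i => ?_) (Eventually.of_forall ?_)
    · exact ((summable_nat_add_iff 1).2 summable_geometric_two).mul_right _
    · have h := ((hM.tendsto_div_add hroot i).const_mul (M (i + 1))).const_mul
        ((1 / 2 : ℝ) ^ (i + 1))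
      simp only [mul_zero] at h
      rw [← tendsto_add_atTop_iff_nat i]
      refine h.congr fun k => ?_
      simp [g, add_assoc]
    · intro k i
      by_cases hik : i ≤ k
      · have h1 := hM.mul_le_mul_add (i + 1) (k - i)
        rw [show i + 1 + (k - i) = k + 1 by omega] at h1
        have h2 : M (i + 1) * (M (k - i) / M (k + 1)) ≤ M 0 := by
          rw [← mul_div_assoc, div_le_iff₀ (hM.pos _)]
          exact h1
        have h3 : 0 ≤ M (i + 1) * (M (k - i) / M (k + 1)) :=
          mul_nonneg (hM.pos _).le (div_pos (hM.pos _) (hM.pos _)).le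
        simp only [g, if_pos hik]
        rw [Real.norm_of_nonneg (by positivity)]
        exact mul_le_mul_of_nonneg_left h2 (by positivity)
      · simp only [g, if_neg hik, norm_zero]
        have := (hM.pos 0).le
        positivity
  rw [tsum_zero] at hlim
  have hlim' := hlim.const_mul A
  rw [mul_zero] at hlim'
  filter_upwards [hlim'.eventually_le_const one_pos] with k hk
  have hsum : ∑' i, g k i = ∑ i ∈ Finset.range (k + 1),
      (1 / 2 : ℝ) ^ (i + 1) * (M (i + 1) * (M (k - i) / M (k + 1))) := by
    rw [tsum_eq_sum (s := Finset.range (k + 1))]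
    · refine Finset.sum_congr rfl fun i hi => ?_
      simp only [g, if_pos (Nat.lt_succ_iff.1 (Finset.mem_range.1 hi))]
    · intro i hi
      simp only [g, if_neg (fun h => hi (Finset.mem_range.2 (Nat.lt_succ_of_le h)))]
  rw [hsum] at hk
  have hpos := hM.pos (k + 1)
  calc _ = (A * ∑ i ∈ Finset.range (k + 1),
      (1 / 2 : ℝ) ^ (i + 1) * (M (i + 1) * (M (k - i) / M (k + 1)))) * M (k + 1) := by
        rw [mul_assoc, Finset.sum_mul]
        congr 1
        refine Finset.sum_congr rfl fun i _ => ?_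
        field_simp
    _ ≤ 1 * M (k + 1) := mul_le_mul_of_nonneg_right hk hpos.le
    _ = _ := one_mul _

/-- If moreover `M k ^ (1 / k) → ∞`, then the convolution inequality of `le_of_convolution` only
costs a factor `2` in the geometric rate: the terms with large index are small because of the
geometric factor, those with small index because `M k / M (k + i) → 0`. -/
theorem exists_le_of_convolution (hM : IsWeightSequence M)
    (hroot : Tendsto (fun k : ℕ => M k ^ ((1 : ℝ) / (k : ℝ))) atTop atTop) {A B σ : ℝ}
    (hA : 0 ≤ A) (hσ : 0 < σ) (hB : 0 ≤ B) :
    ∃ D, ∀ s : ℕ → ℝ, s 0 ≤ B → (∀ k, s (k + 1) ≤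
        A * ∑ i ∈ Finset.range (k + 1), (σ / 2) ^ (i + 1) * M (i + 1) * s (k - i)) →
      ∀ k, s k ≤ D * (σ ^ k * M k) := by
  obtain ⟨k₀, hk₀⟩ := eventually_atTop.1 (hM.eventually_convolution_le hroot A)
  have hM0 := hM.pos 0
  set σ' := σ / 2 * (1 + A * M 0) with hσ'
  have hσ'0 : 0 < σ' := by positivity
  set q := max 1 (σ' / σ) with hq
  have hq1 : 1 ≤ q := le_max_left _ _
  have hq0 : 0 ≤ q := by positivity
  refine ⟨B / M 0 * q ^ k₀, fun s hs0 hrec k => ?_⟩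
  have hD : 0 ≤ B / M 0 * q ^ k₀ := by positivity
  induction k using Nat.strong_induction_on with
  | _ k ih =>
    -- up to `k₀` the bound with the larger rate `σ'` suffices, since `D` may depend on `k₀`
    rcases le_or_gt k k₀ with hk | hk
    · refine (hM.le_of_convolution hA (half_pos hσ) hs0 hrec hB k).trans ?_
      rw [mul_assoc]
      refine mul_le_mul_of_nonneg_left ?_ (by positivity)
      rw [← mul_assoc]
      refine mul_le_mul_of_nonneg_right ?_ (hM.pos k).le
      calc σ' ^ k = (σ' / σ) ^ k * σ ^ k := by rw [← mul_pow]; congr 1; field_simp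
        _ ≤ q ^ k * σ ^ k := by gcongr; exact le_max_right _ _
        _ ≤ q ^ k₀ * σ ^ k := by gcongr
    · obtain ⟨k, rfl⟩ : ∃ j, k = j + 1 := ⟨k - 1, by omega⟩
      calc s (k + 1)
          ≤ A * ∑ i ∈ Finset.range (k + 1), (σ / 2) ^ (i + 1) * M (i + 1) * s (k - i) := hrec k
        _ ≤ A * ∑ i ∈ Finset.range (k + 1), (B / M 0 * q ^ k₀ * σ ^ (k + 1)) *
              ((1 / 2 : ℝ) ^ (i + 1) * (M (i + 1) * M (k - i))) := by
            refine mul_le_mul_of_nonneg_left (Finset.sum_le_sum fun i hi => ?_) hA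
            have hik : k + 1 = (i + 1) + (k - i) := by have := Finset.mem_range.1 hi; omega
            calc (σ / 2) ^ (i + 1) * M (i + 1) * s (k - i)
                ≤ (σ / 2) ^ (i + 1) * M (i + 1) *
                    (B / M 0 * q ^ k₀ * (σ ^ (k - i) * M (k - i))) :=
                  mul_le_mul_of_nonneg_left (ih _ (by omega))
                    (mul_nonneg (by positivity) (hM.pos _).le)
              _ = _ := by rw [hik, pow_add σ, div_eq_mul_one_div, mul_pow]; ring_nf
        _ = (B / M 0 * q ^ k₀ * σ ^ (k + 1)) * (A * ∑ i ∈ Finset.range (k + 1),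
              (1 / 2 : ℝ) ^ (i + 1) * (M (i + 1) * M (k - i))) := by
            rw [← Finset.mul_sum]; ring
        _ ≤ (B / M 0 * q ^ k₀ * σ ^ (k + 1)) * M (k + 1) :=
            mul_le_mul_of_nonneg_left (hk₀ k (by omega)) (by positivity)
        _ = _ := by ring

end IsWeightSequence

/-! ### Local Hölder classes -/

section Holder

universe u

/-- `f` is of class `C^{k,α}` near `x`: it is `C^k` at `x` and its `k`-th derivative is `α`-Hölder
on a neighbourhood of `x`. -/
def HolderClassAt {X F : Type*} [NormedAddCommGroup X] [NormedSpace ℝ X]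
    [NormedAddCommGroup F] [NormedSpace ℝ F] (k : ℕ) (α : ℝ≥0) (f : X → F) (x : X) : Prop :=
  ContDiffAt ℝ k f x ∧ ∃ N ∈ 𝓝 x, ∃ C : ℝ≥0, HolderOnWith C α (iteratedFDeriv ℝ k f) N

variable {X F G : Type*} [NormedAddCommGroup X] [NormedSpace ℝ X]
  [NormedAddCommGroup F] [NormedSpace ℝ F] [NormedAddCommGroup G] [NormedSpace ℝ G]
  {k : ℕ} {α : ℝ≥0} {f : X → F} {x : X}

theorem holderOnWith_congr {X F : Type*} [PseudoEMetricSpace X] [PseudoEMetricSpace F]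
    {C α : ℝ≥0} {f g : X → F} {N : Set X} (h : ∀ y ∈ N, f y = g y)
    (hf : HolderOnWith C α f N) : HolderOnWith C α g N := fun y hy z hz => by
  rw [← h y hy, ← h z hz]
  exact hf y hy z hz

theorem holderOnWith_isometry_comp {X F G : Type*} [PseudoEMetricSpace X] [PseudoEMetricSpace F]
    [PseudoEMetricSpace G] {C α : ℝ≥0} {f : X → F} {N : Set X} {Φ : F → G} (hΦ : Isometry Φ) :
    HolderOnWith C α (Φ ∘ f) N ↔ HolderOnWith C α f N := by
  simp only [HolderOnWith, Function.comp, hΦ.edist_eq]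

/-- A `C^1` map is locally `α`-Hölder for each `α ≤ 1`. -/
theorem ContDiffAt.exists_holderOnWith (hf : ContDiffAt ℝ 1 f x) (hα : α ≤ 1) :
    ∃ N ∈ 𝓝 x, ∃ C : ℝ≥0, HolderOnWith C α f N := by
  obtain ⟨K, t, ht, hK⟩ := hf.exists_lipschitzOnWith
  refine ⟨t ∩ Metric.closedBall x 1, inter_mem ht (Metric.closedBall_mem_nhds x one_pos), _,
    HolderOnWith.of_le (D := 2) ?_ ((holderOnWith_one.2 hK).mono Set.inter_subset_left) hα⟩
  rintro y ⟨-, hy⟩ z ⟨-, hz⟩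
  rw [edist_dist, ENNReal.ofReal_le_iff_le_toReal (by simp)]
  have := dist_triangle_right y z x
  rw [Metric.mem_closedBall] at hy hz
  norm_num
  linarith

namespace HolderClassAt

theorem congr {g : X → F} (hf : HolderClassAt k α f x) (h : f =ᶠ[𝓝 x] g) :
    HolderClassAt k α g x := by
  obtain ⟨h1, N, hN, C, hC⟩ := hf
  have h' := h.iteratedFDeriv ℝ k
  exact ⟨h1.congr_of_eventuallyEq h.symm, N ∩ {y | iteratedFDeriv ℝ k f y = iteratedFDeriv ℝ k g y},
    inter_mem hN h', C, holderOnWith_congr (fun y hy => hy.2) (hC.mono Set.inter_subset_left)⟩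

theorem zero_iff (hα : 0 < α) :
    HolderClassAt 0 α f x ↔ ∃ N ∈ 𝓝 x, ∃ C : ℝ≥0, HolderOnWith C α f N := by
  simp only [HolderClassAt, iteratedFDeriv_zero_eq_comp,
    holderOnWith_isometry_comp (LinearIsometryEquiv.isometry _)]
  refine ⟨fun h => h.2, fun h => ⟨?_, h⟩⟩
  obtain ⟨N, hN, C, hC⟩ := h
  rw [Nat.cast_zero, contDiffAt_zero]
  exact ⟨N, hN, hC.continuousOn hα⟩

theorem succ_iff :
    HolderClassAt (k + 1) α f x ↔
      (∀ᶠ y in 𝓝 x, DifferentiableAt ℝ f y) ∧ HolderClassAt k α (fderiv ℝ f) x := by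
  have hiso : ∀ (N : Set X) (C : ℝ≥0), HolderOnWith C α (iteratedFDeriv ℝ (k + 1) f) N ↔
      HolderOnWith C α (iteratedFDeriv ℝ k (fderiv ℝ f)) N := by
    intro N C
    rw [show iteratedFDeriv ℝ (k + 1) f = _ from funext fun y => iteratedFDeriv_succ_eq_comp_right]
    exact holderOnWith_isometry_comp (LinearIsometryEquiv.isometry _)
  simp only [HolderClassAt, hiso, ← and_assoc]
  refine and_congr_left fun _ => ⟨fun h => ?_, fun h => ?_⟩
  · refine ⟨?_, h.fderiv_right (by norm_cast)⟩
    filter_upwards [h.eventually (by norm_cast; exact WithTop.coe_ne_top)] with y hy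
    exact hy.differentiableAt (by norm_cast)
  · push_cast
    exact contDiffAt_succ_iff_hasFDerivAt.2
      ⟨fderiv ℝ f, ⟨_, h.1, fun y hy => DifferentiableAt.hasFDerivAt hy⟩, h.2⟩

theorem _root_.ContDiffAt.holderClassAt (hf : ContDiffAt ℝ (k + 1) f x) (hα : α ≤ 1) :
    HolderClassAt k α f x :=
  ⟨hf.of_le (by norm_cast; omega),
    (hf.iteratedFDeriv_right (m := 1) (by rw [add_comm])).exists_holderOnWith hα⟩

theorem of_succ (hf : HolderClassAt (k + 1) α f x) (hα : α ≤ 1) : HolderClassAt k α f x :=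
  ContDiffAt.holderClassAt (by exact_mod_cast hf.1) hα

theorem prodMk {g : X → G} (hf : HolderClassAt k α f x) (hg : HolderClassAt k α g x) :
    HolderClassAt k α (fun y => (f y, g y)) x := by
  obtain ⟨hf1, N, hN, C, hC⟩ := hf
  obtain ⟨hg1, N', hN', C', hC'⟩ := hg
  have hk : (k : WithTop ℕ∞) ≠ ∞ := by norm_cast; exact WithTop.coe_ne_top
  refine ⟨hf1.prodMk hg1, _, inter_mem (inter_mem hN hN')
    ((hf1.eventually hk).and (hg1.eventually hk)), max C C', ?_⟩
  have hp : HolderOnWith (max C C') α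
      (fun y => (iteratedFDeriv ℝ k f y, iteratedFDeriv ℝ k g y)) (N ∩ N') := by
    intro y hy z hz
    rw [Prod.edist_eq]
    refine max_le ((hC y hy.1 z hz.1).trans ?_) ((hC' y hy.2 z hz.2).trans ?_)
    · gcongr; exact le_max_left _ _
    · gcongr; exact le_max_right _ _
  refine holderOnWith_congr ?_ ((holderOnWith_isometry_comp
    (ContinuousMultilinearMap.prodL ℝ (fun _ : Fin k => X) F G).isometry).2
      (hp.mono Set.inter_subset_left))
  rintro y ⟨-, hy1, hy2⟩
  exact (iteratedFDeriv_prodMk hy1 hy2 le_rfl).symm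

/-- The composition of a `C^{k,α}` map with a smooth map is `C^{k,α}`, by induction on `k`. All
spaces but the source lie in one universe since the induction passes to spaces of operators. -/
theorem comp_contDiffAt {X : Type} [NormedAddCommGroup X] [NormedSpace ℝ X] {x : X}
    (hα0 : 0 < α) (hα : α ≤ 1) (k : ℕ) :
    ∀ {F G : Type u} [NormedAddCommGroup F] [NormedSpace ℝ F] [NormedAddCommGroup G]
      [NormedSpace ℝ G] {g : F → G} {f : X → F}, ContDiffAt ℝ ∞ g (f x) →
      HolderClassAt k α f x → HolderClassAt k α (fun y => g (f y)) x := by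
  induction k with
  | zero =>
    intro F G _ _ _ _ g f hg hf
    have hcont : ContinuousAt f x := hf.1.continuousAt
    obtain ⟨N, hN, C, hC⟩ := (zero_iff hα0).1 hf
    obtain ⟨N', hN', C', hC'⟩ :=
      (hg.of_le (by exact_mod_cast le_top : (1 : WithTop ℕ∞) ≤ ∞)).exists_holderOnWith le_rfl
    have := hC'.comp (hC.mono Set.inter_subset_left) (fun y (hy : y ∈ N ∩ f ⁻¹' N') => hy.2)
    rw [one_mul] at this
    exact (zero_iff hα0).2 ⟨_, inter_mem hN (hcont hN'), _, this⟩
  | succ k ih =>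
    intro F G _ _ _ _ g f hg hf
    have hcont : ContinuousAt f x := hf.1.continuousAt
    have hg' : ∀ᶠ a in 𝓝 (f x), DifferentiableAt ℝ g a := by
      filter_upwards [(hg.of_le (by exact_mod_cast le_top : (1 : WithTop ℕ∞) ≤ ∞)).eventually
        (by norm_cast)] with a ha
      exact ha.differentiableAt (by norm_num)
    obtain ⟨hfd, hf'⟩ := succ_iff.1 hf
    refine succ_iff.2 ⟨?_, ?_⟩
    · filter_upwards [hfd, hcont hg'] with y hy hgy
      exact DifferentiableAt.comp y hgy hy
    · have hsmooth : ContDiffAt ℝ ∞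
          (fun p : F × (X →L[ℝ] F) => (fderiv ℝ g p.1).comp p.2) (f x, fderiv ℝ f x) :=
        ContDiffAt.clm_comp
          ((hg.fderiv_right (m := ∞) (by norm_cast)).comp (f x, fderiv ℝ f x) contDiffAt_fst)
          contDiffAt_snd
      refine (ih hsmooth ((hf.of_succ hα).prodMk hf')).congr ?_
      filter_upwards [hfd, hcont hg'] with y hy hgy
      exact (fderiv_comp y hgy hy).symm

theorem clm_comp (L : F →L[ℝ] G) (hf : HolderClassAt k α f x) :
    HolderClassAt k α (fun y => L (f y)) x := by
  obtain ⟨h1, N, hN, C, hC⟩ := hf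
  have hk : (k : WithTop ℕ∞) ≠ ∞ := by norm_cast; exact WithTop.coe_ne_top
  refine ⟨L.contDiff.contDiffAt.comp x h1, _, inter_mem hN (h1.eventually hk), ?_⟩
  let Φ := ContinuousLinearMap.compContinuousMultilinearMapL ℝ (fun _ : Fin k => X) F G L
  have h2 := (holderOnWith_one.2 (Φ.lipschitz.lipschitzOnWith (s := Set.univ))).comp
    (hC.mono (s := N) (t := N ∩ {y | ContDiffAt ℝ k f y}) Set.inter_subset_left)
    (fun _ _ => Set.mem_univ _)
  rw [one_mul] at h2
  exact ⟨_, holderOnWith_congr (fun y hy => (L.iteratedFDeriv_comp_left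
    (show ContDiffAt ℝ k f y from hy.2) le_rfl).symm) h2⟩

theorem comp_clm {Y : Type*} [NormedAddCommGroup Y] [NormedSpace ℝ Y] (L : Y →L[ℝ] X) {y : Y}
    (hfk : ContDiff ℝ k f) (hf : HolderClassAt k α f (L y)) :
    HolderClassAt k α (fun y => f (L y)) y := by
  obtain ⟨h1, N, hN, C, hC⟩ := hf
  refine ⟨h1.comp y L.contDiff.contDiffAt, L ⁻¹' N, L.continuous.continuousAt hN, ?_⟩
  let Φ := ContinuousMultilinearMap.compContinuousLinearMapL (𝕜 := ℝ) (F := F)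
    (fun _ : Fin k => L)
  have h2 := hC.comp (holderOnWith_one.2 (L.lipschitz.lipschitzOnWith (s := L ⁻¹' N)))
    (fun _ h => h)
  have h3 := (holderOnWith_one.2 (Φ.lipschitz.lipschitzOnWith (s := Set.univ))).comp h2
    (fun _ _ => Set.mem_univ _)
  rw [mul_one, one_mul] at h3
  exact ⟨_, holderOnWith_congr (fun y _ => (L.iteratedFDeriv_comp_right hfk y le_rfl).symm) h3⟩

end HolderClassAt

theorem HolderClassAt.sub {X F : Type*} [NormedAddCommGroup X] [NormedSpace ℝ X]
    [NormedAddCommGroup F] [NormedSpace ℝ F] {k : ℕ} {α : ℝ≥0} {f g : X → F} {x : X}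
    (hf : HolderClassAt k α f x) (hg : HolderClassAt k α g x) :
    HolderClassAt k α (fun y => f y - g y) x :=
  (hf.prodMk hg).clm_comp (ContinuousLinearMap.fst ℝ F F - ContinuousLinearMap.snd ℝ F F)

/-- A map that is locally `α`-Hölder near each point of a compact set is `α`-Hölder on it. -/
theorem IsCompact.exists_holderOnWith {X F : Type*} [PseudoMetricSpace X] [PseudoMetricSpace F]
    {f : X → F} {K : Set X} (hK : IsCompact K) (hα : 0 < α)
    (h : ∀ x ∈ K, ∃ N ∈ 𝓝 x, ∃ C : ℝ≥0, HolderOnWith C α f N) :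
    ∃ C : ℝ, ∀ y ∈ K, ∀ z ∈ K, dist (f y) (f z) ≤ C * dist y z ^ (α : ℝ) := by
  suffices h : ∃ C : ℝ, ∀ p ∈ K ×ˢ K, dist (f p.1) (f p.2) ≤ C * dist p.1 p.2 ^ (α : ℝ) by
    obtain ⟨C, hC⟩ := h
    exact ⟨C, fun y hy z hz => hC (y, z) ⟨hy, hz⟩⟩
  have hcont : ∀ x ∈ K, ContinuousAt f x := fun x hx => by
    obtain ⟨N, hN, C, hC⟩ := h x hx
    exact (hC.continuousOn hα).continuousAt hN
  refine (hK.prod hK).induction_on (p := fun s => ∃ C : ℝ, ∀ p ∈ s,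
    dist (f p.1) (f p.2) ≤ C * dist p.1 p.2 ^ (α : ℝ)) ⟨0, by simp⟩ ?_ ?_ ?_
  · rintro s t hst ⟨C, hC⟩
    exact ⟨C, fun p hp => hC p (hst hp)⟩
  · rintro s t ⟨C, hC⟩ ⟨C', hC'⟩
    refine ⟨max C C', ?_⟩
    rintro p (hp | hp)
    · refine (hC p hp).trans ?_; gcongr; exact le_max_left _ _
    · refine (hC' p hp).trans ?_; gcongr; exact le_max_right _ _
  · rintro ⟨y, z⟩ ⟨hy, hz⟩
    simp only at hy hz
    by_cases hyz : dist y z = 0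
    · -- near the diagonal the local Hölder bound applies
      obtain ⟨N, hN, C, hC⟩ := h y hy
      have hN' : N ∈ 𝓝 z := by
        rw [← (Metric.inseparable_iff.2 hyz : Inseparable y z).nhds_eq]
        exact hN
      exact ⟨N ×ˢ N, mem_nhdsWithin_of_mem_nhds (prod_mem_nhds hN hN'), C,
        fun p hp => hC.dist_le hp.1 hp.2⟩
    · -- away from the diagonal the distance is bounded below
      have hd : 0 < dist y z := lt_of_le_of_ne dist_nonneg (Ne.symm hyz)
      have h1 : ContinuousAt (fun p : X × X => dist (f p.1) (f p.2)) (y, z) :=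
        Filter.Tendsto.dist (ContinuousAt.comp (f := Prod.fst) (hcont y hy) continuousAt_fst)
          (ContinuousAt.comp (f := Prod.snd) (hcont z hz) continuousAt_snd)
      have h2 : ContinuousAt (fun p : X × X => dist p.1 p.2) (y, z) := continuous_dist.continuousAt
      refine ⟨_, mem_nhdsWithin_of_mem_nhds ((h1.eventually_lt continuousAt_const
        (lt_add_one (dist (f y) (f z)))).and (continuousAt_const.eventually_lt h2
          (half_lt_self hd))), (dist (f y) (f z) + 1) / (dist y z / 2) ^ (α : ℝ), ?_⟩
      rintro p ⟨hp1, hp2⟩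
      have h3 : 0 < (dist y z / 2) ^ (α : ℝ) := by positivity
      rw [div_mul_eq_mul_div, le_div_iff₀ h3]
      refine mul_le_mul hp1.le ?_ h3.le (by positivity)
      exact Real.rpow_le_rpow (by positivity) hp2.le α.2

end Holder

/-! ### From matrix coefficients to operator-valued maps -/

theorem HolderClassAt.of_le {X F : Type*} [NormedAddCommGroup X] [NormedSpace ℝ X]
    [NormedAddCommGroup F] [NormedSpace ℝ F] {k m : ℕ} {α : ℝ≥0} {f : X → F} {x : X}
    (hf : HolderClassAt k α f x) (hα : α ≤ 1) (hm : m ≤ k) : HolderClassAt m α f x := by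
  induction k, hm using Nat.le_induction with
  | base => exact hf
  | succ k _ ih => exact ih (hf.of_succ hα)

theorem holderOnWith_of_dist_le {X F : Type*} [PseudoMetricSpace X] [PseudoMetricSpace F]
    {f : X → F} {N : Set X} {C : ℝ} {α : ℝ≥0} (hC : 0 ≤ C)
    (h : ∀ y ∈ N, ∀ z ∈ N, dist (f y) (f z) ≤ C * dist y z ^ (α : ℝ)) :
    HolderOnWith C.toNNReal α f N := by
  intro y hy z hz
  rw [edist_dist, edist_dist, ENNReal.ofReal_rpow_of_nonneg dist_nonneg α.coe_nonneg]
  change _ ≤ ENNReal.ofReal C * _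
  rw [← ENNReal.ofReal_mul hC]
  exact ENNReal.ofReal_le_ofReal (h y hy z hz)

/-- Taylor's estimate of first order for `C^{1,α}` maps on a closed ball. -/
theorem exists_taylor_le {X F : Type*} [NormedAddCommGroup X] [NormedSpace ℝ X]
    [FiniteDimensional ℝ X] [NormedAddCommGroup F] [NormedSpace ℝ F] {α : ℝ≥0} {g : X → F}
    (hα : 0 < α) (h : ∀ x, HolderClassAt 1 α g x) (x : X) (R : ℝ) :
    ∃ C : ℝ, ∀ e, ‖e‖ ≤ R →
      ‖g (x + e) - g x - fderiv ℝ g x e‖ ≤ C * (‖e‖ ^ (α : ℝ) * ‖e‖) := by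
  have := FiniteDimensional.proper ℝ X
  obtain ⟨C, hC⟩ := (isCompact_closedBall x R).exists_holderOnWith hα
    (fun y _ => (HolderClassAt.zero_iff hα).1 (HolderClassAt.succ_iff.1 (h y)).2)
  refine ⟨max C 0, fun e he => ?_⟩
  have hR : 0 ≤ R := (norm_nonneg e).trans he
  have hsub : Metric.closedBall x ‖e‖ ⊆ Metric.closedBall x R :=
    Metric.closedBall_subset_closedBall he
  have hbound : ∀ y ∈ Metric.closedBall x ‖e‖,
      ‖fderiv ℝ g y - fderiv ℝ g x‖ ≤ max C 0 * ‖e‖ ^ (α : ℝ) := by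
    intro y hy
    rw [← dist_eq_norm]
    refine (hC y (hsub hy) x (Metric.mem_closedBall_self hR)).trans ?_
    refine mul_le_mul (le_max_left _ _) ?_ (by positivity) (le_max_right _ _)
    exact Real.rpow_le_rpow dist_nonneg hy α.2
  have := (convex_closedBall x ‖e‖).norm_image_sub_le_of_norm_fderiv_le' (𝕜 := ℝ)
    (fun y _ => (h y).1.differentiableAt (by norm_num)) hbound
    (Metric.mem_closedBall_self (norm_nonneg e)) (y := x + e) (by simp)
  simpa [mul_assoc] using this

section Coefficients

variable {W H : Type*} [NormedAddCommGroup W] [NormedSpace ℂ W] [NormedAddCommGroup H]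
  [InnerProductSpace ℂ H]

/-- The matrix coefficient `a ↦ ⟨v, a u⟩` of operators `a`, as a real-linear functional. -/
noncomputable def matrixCoeff (u : W) (v : H) : (W →L[ℂ] H) →L[ℝ] ℂ :=
  ((innerSL ℂ v).comp (ContinuousLinearMap.apply ℂ H u)).restrictScalars ℝ

theorem matrixCoeff_apply (u : W) (v : H) (a : W →L[ℂ] H) :
    matrixCoeff u v a = inner ℂ v (a u) := rfl

theorem ext_matrixCoeff {a b : W →L[ℂ] H} (h : ∀ u v, matrixCoeff u v a = matrixCoeff u v b) :
    a = b :=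
  ContinuousLinearMap.ext fun u => ext_inner_left ℂ fun v => h u v

theorem iteratedFDeriv_matrixCoeff {X : Type*} [NormedAddCommGroup X] [NormedSpace ℝ X]
    {f : X → W →L[ℂ] H} {k : ℕ} (hf : ContDiff ℝ k f) (u : W) (v : H) (x : X)
    (m : Fin k → X) :
    matrixCoeff u v (iteratedFDeriv ℝ k f x m) =
      iteratedFDeriv ℝ k (fun y => matrixCoeff u v (f y)) x m := by
  have h := (matrixCoeff u v).iteratedFDeriv_comp_left (x := x) hf.contDiffAt le_rfl
  exact (congrArg (fun L => L m) h).symm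

variable [CompleteSpace W] [CompleteSpace H]

theorem exists_norm_le_of_matrixCoeff {ι : Type*} (a : ι → W →L[ℂ] H) (g : ι → ℝ)
    (hg : ∀ i, 0 ≤ g i) (h : ∀ u v, ∃ C : ℝ, ∀ i, ‖matrixCoeff u v (a i)‖ ≤ C * g i) :
    ∃ C : ℝ, 0 ≤ C ∧ ∀ i, ‖a i‖ ≤ C * g i := by
  obtain ⟨-, C, hC⟩ := exists_norm_le_mul_weight_of_inner a (fun _ => g) (fun _ => hg)
    (fun _ => monotone_const) (fun u v => ⟨0, h u v⟩)
  exact ⟨C, hC⟩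

variable {X : Type*} [NormedAddCommGroup X] [NormedSpace ℝ X] [FiniteDimensional ℝ X]
  {α : ℝ≥0} {f : X → W →L[ℂ] H}

/-- If the matrix coefficients of `f` are `C^{1,α}`, then `f` is differentiable in norm: by uniform
boundedness the difference quotients converge at a uniform rate. -/
theorem differentiable_of_matrixCoeff (hα : 0 < α)
    (h : ∀ u v x, HolderClassAt 1 α (fun y => matrixCoeff u v (f y)) x) : Differentiable ℝ f := by
  have hα' : (0 : ℝ) < α := hα
  -- the directional derivative as the limit of a Cauchy sequence of difference quotients `q n`
  have hD : ∀ x e, ∃ d : W →L[ℂ] H, ∀ u v,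
      matrixCoeff u v d = fderiv ℝ (fun y => matrixCoeff u v (f y)) x e := by
    intro x e
    let t : ℕ → ℝ := fun n => ((n : ℝ) + 1)⁻¹
    have ht0 : ∀ n, 0 < t n := fun n => by positivity
    have ht1 : ∀ n, t n ≤ 1 := fun n => inv_le_one_of_one_le₀ (by simp)
    have htlim : Tendsto t atTop (𝓝 0) := by
      simpa [t, one_div] using tendsto_one_div_add_atTop_nhds_zero_nat (𝕜 := ℝ)
    let q : ℕ → W →L[ℂ] H := fun n => (t n)⁻¹ • (f (x + t n • e) - f x)
    let b : ℕ → ℝ := fun n => (t n * ‖e‖) ^ (α : ℝ) * ‖e‖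
    have hb0 : ∀ n, 0 ≤ b n := fun n => by have := ht0 n; positivity
    have hblim : Tendsto b atTop (𝓝 0) := by
      have h1 := ((htlim.mul_const ‖e‖).rpow_const (p := (α : ℝ)) (Or.inr α.2)).mul_const ‖e‖
      simpa [Real.zero_rpow hα'.ne'] using h1
    have hq : ∀ u v, ∃ C : ℝ, ∀ n, ‖matrixCoeff u v (q n) -
        fderiv ℝ (fun y => matrixCoeff u v (f y)) x e‖ ≤ C * b n := by
      intro u v
      obtain ⟨C, hC⟩ := exists_taylor_le hα (h u v) x ‖e‖
      refine ⟨C, fun n => ?_⟩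
      have ht := ht0 n
      have hn : ‖t n • e‖ = t n * ‖e‖ := by rw [norm_smul, Real.norm_of_nonneg ht.le]
      have h1 := hC (t n • e) (by
        rw [hn]; exact mul_le_of_le_one_left (norm_nonneg e) (ht1 n))
      have h2 : matrixCoeff u v (q n) - fderiv ℝ (fun y => matrixCoeff u v (f y)) x e =
          (t n)⁻¹ • (matrixCoeff u v (f (x + t n • e)) - matrixCoeff u v (f x) -
            fderiv ℝ (fun y => matrixCoeff u v (f y)) x (t n • e)) := by
        rw [map_smul (fderiv ℝ _ x), smul_sub, inv_smul_smul₀ ht.ne', map_smul, map_sub]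
      rw [h2, norm_smul, norm_inv, Real.norm_of_nonneg ht.le, inv_mul_le_iff₀ ht]
      refine h1.trans_eq ?_
      rw [hn]
      ring
    -- rates for the matrix coefficients give a rate in norm
    obtain ⟨C, hC0, hC⟩ := exists_norm_le_of_matrixCoeff (fun p : ℕ × ℕ => q p.1 - q p.2)
      (fun p => b p.1 + b p.2) (fun p => add_nonneg (hb0 _) (hb0 _)) (fun u v => by
        obtain ⟨C, hC⟩ := hq u v
        refine ⟨C, fun p => ?_⟩
        rw [map_sub, ← sub_sub_sub_cancel_right _ _
          (fderiv ℝ (fun y => matrixCoeff u v (f y)) x e), mul_add]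
        exact (norm_sub_le _ _).trans (add_le_add (hC _) (hC _)))
    have hanti : Antitone b := by
      intro n m hnm
      have h3 : t m ≤ t n := inv_anti₀ (by positivity) (by exact_mod_cast Nat.succ_le_succ hnm)
      have := ht0 m
      dsimp only [b]
      gcongr
    have hcauchy : CauchySeq q := by
      refine cauchySeq_of_le_tendsto_0 (fun n => C * (b n + b n)) (fun n m N hn hm => ?_) ?_
      · rw [dist_eq_norm]
        exact (hC (n, m)).trans (mul_le_mul_of_nonneg_left
          (add_le_add (hanti hn) (hanti hm)) hC0)
      · simpa using (hblim.add hblim).const_mul C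
    obtain ⟨d, hd⟩ := cauchySeq_tendsto_of_complete hcauchy
    refine ⟨d, fun u v => tendsto_nhds_unique
      (((matrixCoeff u v).continuous.tendsto d).comp hd) ?_⟩
    obtain ⟨C', hC'⟩ := hq u v
    rw [tendsto_iff_norm_sub_tendsto_zero]
    exact squeeze_zero (fun _ => norm_nonneg _) hC' (by simpa using hblim.const_mul C')
  choose D hD using hD
  intro x
  let L : X →ₗ[ℝ] (W →L[ℂ] H) :=
    { toFun := D x
      map_add' := fun a b => ext_matrixCoeff fun u v => by simp only [map_add, hD]
      map_smul' := fun c a => ext_matrixCoeff fun u v => by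
        simp only [map_smul, hD, RingHom.id_apply] }
  -- the Taylor remainder is `O(‖e‖ ^ (1 + α))` in norm
  obtain ⟨C, hC0, hC⟩ := exists_norm_le_of_matrixCoeff
    (fun e : Metric.closedBall (0 : X) 1 => f (x + e) - f x - D x e)
    (fun e => ‖(e : X)‖ ^ (α : ℝ) * ‖(e : X)‖) (fun e => by positivity) (fun u v => by
      obtain ⟨C, hC⟩ := exists_taylor_le hα (h u v) x 1
      refine ⟨C, fun e => ?_⟩
      rw [map_sub, map_sub, hD]
      exact hC e (mem_closedBall_zero_iff.1 e.2))
  have hderiv : HasFDerivAt f (LinearMap.toContinuousLinearMap L) x := by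
    rw [hasFDerivAt_iff_isLittleO_nhds_zero, Asymptotics.isLittleO_iff]
    intro c hc
    have hlim : Tendsto (fun e : X => C * ‖e‖ ^ (α : ℝ)) (𝓝 0) (𝓝 0) := by
      have h1 : Tendsto (fun e : X => ‖e‖) (𝓝 0) (𝓝 0) := by
        simpa using (continuous_norm (E := X)).tendsto 0
      simpa [Real.zero_rpow hα'.ne'] using (h1.rpow_const (p := (α : ℝ)) (Or.inr α.2)).const_mul C
    filter_upwards [hlim.eventually_le_const hc, Metric.closedBall_mem_nhds (0 : X) one_pos]
      with e he1 he2
    refine (hC ⟨e, he2⟩).trans ?_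
    rw [← mul_assoc]
    exact mul_le_mul_of_nonneg_right he1 (norm_nonneg e)
  exact hderiv.differentiableAt

/-- If the matrix coefficients of `f` are `C^{k,α}`, then `f` is `C^k` in norm. -/
theorem contDiff_of_matrixCoeff (hα : 0 < α) (hα1 : α ≤ 1) (k : ℕ) :
    ∀ {f : X → W →L[ℂ] H}, (∀ u v x, HolderClassAt k α (fun y => matrixCoeff u v (f y)) x) →
      ContDiff ℝ k f := by
  have := FiniteDimensional.proper ℝ X
  induction k with
  | zero =>
    intro f h
    rw [Nat.cast_zero, contDiff_zero, continuous_iff_continuousAt]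
    intro x
    let K := Metric.closedBall x 1
    obtain ⟨C, hC0, hC⟩ := exists_norm_le_of_matrixCoeff
      (fun p : K × K => f p.1 - f p.2) (fun p => dist (p.1 : X) p.2 ^ (α : ℝ))
      (fun p => by positivity) (fun u v => by
        obtain ⟨C, hC⟩ := (isCompact_closedBall x 1).exists_holderOnWith hα
          (fun y _ => (HolderClassAt.zero_iff hα).1 (h u v y))
        refine ⟨C, fun p => ?_⟩
        rw [map_sub, ← dist_eq_norm]
        exact hC _ p.1.2 _ p.2.2)
    refine ((holderOnWith_of_dist_le (N := K) hC0 fun y hy z hz => ?_).continuousOn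
      hα).continuousAt (Metric.closedBall_mem_nhds x one_pos)
    rw [dist_eq_norm]
    exact hC (⟨y, hy⟩, ⟨z, hz⟩)
  | succ k ih =>
    intro f h
    have hd : Differentiable ℝ f :=
      differentiable_of_matrixCoeff hα fun u v x => (h u v x).of_le hα1 (by omega)
    push_cast
    refine contDiff_succ_iff_fderiv_apply.2 ⟨hd, by simp, fun e => ih fun u v x => ?_⟩
    refine ((HolderClassAt.succ_iff.1 (h u v x)).2.clm_comp
      (ContinuousLinearMap.apply ℝ ℂ e)).congr (Eventually.of_forall fun y => ?_)
    have h1 := ((matrixCoeff u v).hasFDerivAt.comp y (hd y).hasFDerivAt).fderiv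
    exact congrArg (fun L => L e) h1

/-- If the matrix coefficients of `f` are `C^{k,α}`, then so is `f`. -/
theorem holderClassAt_of_matrixCoeff (hα : 0 < α) (hα1 : α ≤ 1) (k : ℕ)
    (h : ∀ u v x, HolderClassAt k α (fun y => matrixCoeff u v (f y)) x) (x : X) :
    HolderClassAt k α f x := by
  have := FiniteDimensional.proper ℝ X
  have hk := contDiff_of_matrixCoeff hα hα1 k h
  let K := Metric.closedBall x 1
  obtain ⟨C, hC0, hC⟩ := exists_norm_le_of_matrixCoeff
    (fun p : (K × K) × (Fin k → X) =>
      iteratedFDeriv ℝ k f p.1.1 p.2 - iteratedFDeriv ℝ k f p.1.2 p.2)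
    (fun p => dist (p.1.1 : X) p.1.2 ^ (α : ℝ) * ∏ i, ‖p.2 i‖)
    (fun p => by positivity) (fun u v => by
      obtain ⟨C, hC⟩ := (isCompact_closedBall x 1).exists_holderOnWith hα
        (fun y _ => (h u v y).2)
      refine ⟨C, fun p => ?_⟩
      rw [map_sub, iteratedFDeriv_matrixCoeff hk, iteratedFDeriv_matrixCoeff hk, ← mul_assoc,
        ← sub_apply]
      refine (ContinuousMultilinearMap.le_opNorm _ _).trans
        (mul_le_mul_of_nonneg_right ?_ (by positivity))
      rw [← dist_eq_norm]
      exact hC _ p.1.1.2 _ p.1.2.2)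
  refine ⟨hk.contDiffAt, K, Metric.closedBall_mem_nhds x one_pos, _,
    holderOnWith_of_dist_le hC0 fun y hy z hz => ?_⟩
  rw [dist_eq_norm]
  refine ContinuousMultilinearMap.opNorm_le_bound (by positivity) fun m => ?_
  rw [mul_assoc]
  exact hC ((⟨y, hy⟩, ⟨z, hz⟩), m)

/-- If the matrix coefficients of `f` are smooth, then so is `f`. -/
theorem contDiff_infty_of_matrixCoeff
    (h : ∀ u v, ContDiff ℝ ∞ fun y => matrixCoeff u v (f y)) : ContDiff ℝ ∞ f :=
  contDiff_infty.2 fun k => contDiff_of_matrixCoeff one_pos le_rfl k fun u v x =>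
    ContDiffAt.holderClassAt ((h u v).contDiffAt.of_le (by exact_mod_cast le_top)) le_rfl

end Coefficients

/-! ### Denjoy–Carleman bounds -/

section DenjoyCarleman

/-- The bounds `‖D^k f(x)‖ ≤ C ρ^k k! M_k` on `K`, for the norms of the full derivatives instead of
the partial derivatives in some coordinates. -/
def FDerivBound {X F : Type*} [NormedAddCommGroup X] [NormedSpace ℝ X]
    [NormedAddCommGroup F] [NormedSpace ℝ F] (M : ℕ → ℝ) (K : Set X) (ρ : ℝ) (f : X → F) : Prop :=
  ∃ C : ℝ, ∀ x ∈ K, ∀ k : ℕ, ‖iteratedFDeriv ℝ k f x‖ ≤ C * (ρ ^ k * (k ! : ℝ) * M k)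

section Words

variable {ι X F : Type*} [Fintype ι] [NormedAddCommGroup X] [NormedSpace ℝ X]
  [NormedAddCommGroup F] [NormedSpace ℝ F]

/-- A multilinear map is controlled by its values on words in a basis. -/
theorem ContinuousMultilinearMap.norm_le_of_basis (b : Module.Basis ι ℝ X) {c : ℝ}
    (hc : ∀ x, ∑ i, |b.repr x i| ≤ c * ‖x‖) (hc0 : 0 ≤ c) {k : ℕ}
    (T : ContinuousMultilinearMap ℝ (fun _ : Fin k => X) F) {B : ℝ} (hB0 : 0 ≤ B)
    (hB : ∀ I : Fin k → ι, ‖T fun j => b (I j)‖ ≤ B) : ‖T‖ ≤ c ^ k * B := by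
  refine T.opNorm_le_bound (by positivity) fun m => ?_
  have h1 : T m = ∑ I : Fin k → ι, (∏ j, b.repr (m j) (I j)) • T fun j => b (I j) := by
    conv_lhs => rw [show m = fun j => ∑ i, b.repr (m j) i • b i from
      funext fun j => (b.sum_repr (m j)).symm]
    classical
    rw [T.map_sum]
    exact Finset.sum_congr rfl fun I _ => T.map_smul_univ _ _
  calc ‖T m‖ ≤ ∑ I : Fin k → ι, (∏ j, |b.repr (m j) (I j)|) * B := by
        rw [h1]
        refine norm_sum_le_of_le _ fun I _ => ?_
        rw [norm_smul, norm_prod]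
        exact mul_le_mul_of_nonneg_left (hB I) (by positivity)
    _ = (∏ j, ∑ i, |b.repr (m j) i|) * B := by
        classical
        rw [← Finset.sum_mul, Finset.prod_univ_sum, Fintype.piFinset_univ]
    _ ≤ (∏ j, c * ‖m j‖) * B := by
        gcongr with j
        exact hc (m j)
    _ = c ^ k * B * ∏ j, ‖m j‖ := by
        rw [Finset.prod_mul_distrib, Finset.prod_const, Finset.card_univ, Fintype.card_fin]
        ring

theorem Module.Basis.exists_sum_abs_repr_le (b : Module.Basis ι ℝ X) :
    ∃ c : ℝ, 0 < c ∧ ∀ x, ∑ i, |b.repr x i| ≤ c * ‖x‖ := by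
  have := b.finiteDimensional_of_finite
  let L : ι → X →L[ℝ] ℝ := fun i => LinearMap.toContinuousLinearMap (b.coord i)
  refine ⟨∑ i, ‖L i‖ + 1, by positivity, fun x => ?_⟩
  calc ∑ i, |b.repr x i| ≤ ∑ i, ‖L i‖ * ‖x‖ := Finset.sum_le_sum fun i _ => (L i).le_opNorm x
    _ ≤ _ := by rw [← Finset.sum_mul]; gcongr; linarith

variable {M : ℕ → ℝ} {K : Set X} {f : X → F}

/-- Bounds on the partial derivatives give bounds on the full derivatives, at the cost of scaling
`ρ` by a constant that depends only on the basis. -/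
theorem DenjoyCarlemanBound.exists_fderivBound (hM : ∀ k, 0 < M k) (b : Module.Basis ι ℝ X) :
    ∃ c : ℝ, 0 < c ∧ ∀ ρ : ℝ, 0 ≤ ρ → ∀ f : X → F, DenjoyCarlemanBound M b K ρ f →
      FDerivBound M K (c * ρ) f := by
  obtain ⟨c, hc0, hc⟩ := b.exists_sum_abs_repr_le
  refine ⟨c, hc0, ?_⟩
  rintro ρ hρ f ⟨C, hC⟩
  refine ⟨|C|, fun x hx k => ?_⟩
  have hMk := (hM k).le
  refine ((iteratedFDeriv ℝ k f x).norm_le_of_basis b hc hc0.le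
    (B := |C| * (ρ ^ k * (k ! : ℝ) * M k)) (by positivity) fun I => ?_).trans_eq ?_
  · exact (hC x hx k I).trans (mul_le_mul_of_nonneg_right (le_abs_self C) (by positivity))
  · rw [mul_pow]; ring

theorem FDerivBound.exists_denjoyCarlemanBound (b : Module.Basis ι ℝ X) :
    ∃ c : ℝ, 0 < c ∧ ∀ ρ : ℝ, FDerivBound M K ρ f → DenjoyCarlemanBound M b K (c * ρ) f := by
  refine ⟨∑ i, ‖b i‖ + 1, by positivity, ?_⟩
  rintro ρ ⟨C, hC⟩
  refine ⟨C, fun x hx k I => ?_⟩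
  have h1 : ∏ j, ‖b (I j)‖ ≤ (∑ i, ‖b i‖ + 1) ^ k := by
    calc ∏ j, ‖b (I j)‖ ≤ ∏ _j : Fin k, (∑ i, ‖b i‖ + 1) := by
          refine Finset.prod_le_prod (fun _ _ => norm_nonneg _) fun j _ => ?_
          have := Finset.single_le_sum (f := fun i => ‖b i‖) (fun _ _ => norm_nonneg _)
            (Finset.mem_univ (I j))
          linarith
      _ = _ := by simp
  calc ‖iteratedFDeriv ℝ k f x fun j => b (I j)‖
      ≤ ‖iteratedFDeriv ℝ k f x‖ * ∏ j, ‖b (I j)‖ := ContinuousMultilinearMap.le_opNorm _ _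
    _ ≤ (C * (ρ ^ k * (k ! : ℝ) * M k)) * (∑ i, ‖b i‖ + 1) ^ k :=
        mul_le_mul (hC x hx k) h1 (by positivity) ((norm_nonneg _).trans (hC x hx k))
    _ = _ := by rw [mul_pow]; ring

end Words

variable {W H : Type*} [NormedAddCommGroup W] [NormedSpace ℂ W] [NormedAddCommGroup H]
  [InnerProductSpace ℂ H] [CompleteSpace W] [CompleteSpace H]
  {X : Type*} [NormedAddCommGroup X] [NormedSpace ℝ X]
  {M : ℕ → ℝ} {K : Set X} {f : X → W →L[ℂ] H}

theorem FDerivBound.of_matrixCoeff_beurling (hM : ∀ k, 0 < M k) (hf : ContDiff ℝ ∞ f) {ρ : ℝ}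
    (hρ : 0 < ρ) (h : ∀ u v, FDerivBound M K ρ fun y => matrixCoeff u v (f y)) :
    FDerivBound M K ρ f := by
  have hfk : ∀ k : ℕ, ContDiff ℝ k f := fun k => hf.of_le (by exact_mod_cast le_top)
  obtain ⟨C, hC0, hC⟩ := exists_norm_le_of_matrixCoeff
    (fun p : K × (Σ k : ℕ, Fin k → X) => iteratedFDeriv ℝ p.2.1 f p.1 p.2.2)
    (fun p => ρ ^ p.2.1 * (p.2.1 ! : ℝ) * M p.2.1 * ∏ i, ‖p.2.2 i‖)
    (fun p => by have := (hM p.2.1).le; positivity) (fun u v => by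
      obtain ⟨C, hC⟩ := h u v
      refine ⟨C, fun p => ?_⟩
      rw [iteratedFDeriv_matrixCoeff (hfk _), ← mul_assoc]
      exact (ContinuousMultilinearMap.le_opNorm _ _).trans
        (mul_le_mul_of_nonneg_right (hC _ p.1.2 _) (by positivity)))
  refine ⟨C, fun x hx k => ?_⟩
  have := (hM k).le
  refine ContinuousMultilinearMap.opNorm_le_bound (by positivity) fun m => ?_
  rw [mul_assoc]
  exact hC (⟨x, hx⟩, ⟨k, m⟩)

/-- In the Roumieu case the rate `ρ` may depend on the matrix coefficient; the weights `(n + 1)^k`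
in the uniform boundedness principle make it uniform. -/
theorem FDerivBound.of_matrixCoeff_roumieu (hM : ∀ k, 0 < M k) (hf : ContDiff ℝ ∞ f)
    (h : ∀ u v, ∃ ρ : ℝ, 0 < ρ ∧ FDerivBound M K ρ fun y => matrixCoeff u v (f y)) :
    ∃ ρ : ℝ, 0 < ρ ∧ FDerivBound M K ρ f := by
  have hfk : ∀ k : ℕ, ContDiff ℝ k f := fun k => hf.of_le (by exact_mod_cast le_top)
  obtain ⟨n, C, hC0, hC⟩ := exists_norm_le_mul_weight_of_inner
    (fun p : K × (Σ k : ℕ, Fin k → X) => iteratedFDeriv ℝ p.2.1 f p.1 p.2.2)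
    (fun n p => ((n : ℝ) + 1) ^ p.2.1 * (p.2.1 ! : ℝ) * M p.2.1 * ∏ i, ‖p.2.2 i‖)
    (fun n p => by have := (hM p.2.1).le; positivity) (fun p n m hnm => by
      have := (hM p.2.1).le
      dsimp only
      gcongr) (fun u v => by
      obtain ⟨ρ, hρ, C, hC⟩ := h u v
      obtain ⟨n, hn⟩ := exists_nat_ge ρ
      refine ⟨n, |C|, fun p => ?_⟩
      have hMp := (hM p.2.1).le
      rw [← matrixCoeff_apply, iteratedFDeriv_matrixCoeff (hfk _), ← mul_assoc]
      refine (ContinuousMultilinearMap.le_opNorm _ _).trans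
        (mul_le_mul_of_nonneg_right ((hC _ p.1.2 _).trans ?_) (by positivity))
      gcongr
      · exact le_abs_self C
      · linarith)
  refine ⟨(n : ℝ) + 1, by positivity, C, fun x hx k => ?_⟩
  have := (hM k).le
  refine ContinuousMultilinearMap.opNorm_le_bound (by positivity) fun m => ?_
  rw [mul_assoc]
  exact hC (⟨x, hx⟩, ⟨k, m⟩)

end DenjoyCarleman

namespace FDerivBound

variable {X Y F G : Type*} [NormedAddCommGroup X] [NormedSpace ℝ X] [NormedAddCommGroup Y]
  [NormedSpace ℝ Y] [NormedAddCommGroup F] [NormedSpace ℝ F] [NormedAddCommGroup G]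
  [NormedSpace ℝ G] {M : ℕ → ℝ} {K : Set X} {ρ : ℝ} {f g : X → F}

theorem sub (hf : ContDiff ℝ ∞ f) (hg : ContDiff ℝ ∞ g) (hfM : FDerivBound M K ρ f)
    (hgM : FDerivBound M K ρ g) : FDerivBound M K ρ fun x => f x - g x := by
  obtain ⟨C, hC⟩ := hfM
  obtain ⟨C', hC'⟩ := hgM
  refine ⟨C + C', fun x hx k => ?_⟩
  have h := fun_iteratedFDeriv_sub_apply (𝕜 := ℝ) (x := x) (i := k)
    (hf.contDiffAt.of_le (by exact_mod_cast le_top))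
    (hg.contDiffAt.of_le (by exact_mod_cast le_top))
  rw [h, add_mul]
  exact (norm_sub_le _ _).trans (add_le_add (hC x hx k) (hC' x hx k))

theorem clm_comp (L : F →L[ℝ] G) (hf : ∀ x ∈ K, ContDiffAt ℝ ∞ f x) (h : FDerivBound M K ρ f) :
    FDerivBound M K ρ fun x => L (f x) := by
  obtain ⟨C, hC⟩ := h
  refine ⟨‖L‖ * C, fun x hx k => ?_⟩
  rw [mul_assoc]
  exact (L.norm_iteratedFDeriv_comp_left (hf x hx) (by exact_mod_cast le_top)).trans
    (mul_le_mul_of_nonneg_left (hC x hx k) (norm_nonneg L))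

theorem comp_clm {K : Set Y} (L : Y →L[ℝ] X) (hL : ‖L‖ ≤ 1) (hf : ContDiff ℝ ∞ f)
    (h : FDerivBound M (L '' K) ρ f) : FDerivBound M K ρ fun y => f (L y) := by
  obtain ⟨C, hC⟩ := h
  refine ⟨C, fun y hy k => ?_⟩
  have h1 := L.iteratedFDeriv_comp_right hf y (i := k) (by exact_mod_cast le_top)
  change iteratedFDeriv ℝ k (fun y => f (L y)) y = _ at h1
  rw [h1]
  refine le_trans ?_ (hC (L y) (Set.mem_image_of_mem L hy) k)
  refine (ContinuousMultilinearMap.norm_compContinuousLinearMap_le _ _).trans ?_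
  refine mul_le_of_le_one_right (norm_nonneg _) ?_
  exact Finset.prod_le_one (fun _ _ => norm_nonneg _) fun _ _ => hL

/-- Linear maps have vanishing derivatives of order at least two. -/
theorem of_clm (hM : ∀ k, 0 < M k) (hρ : 0 < ρ) (hK : IsCompact K) (L : X →L[ℝ] F) :
    FDerivBound M K ρ fun x => L x := by
  obtain ⟨B, hB⟩ := hK.exists_bound_of_continuousOn L.continuous.continuousOn
  refine ⟨max (|B| / M 0) (‖L‖ / (ρ * M 1)), fun x hx k => ?_⟩
  have h0 := hM 0
  have h1 := hM 1
  match k with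
  | 0 =>
    rw [norm_iteratedFDeriv_zero]
    refine ((hB x hx).trans (le_abs_self B)).trans ?_
    rw [pow_zero, Nat.factorial_zero, Nat.cast_one, one_mul, one_mul, ← div_le_iff₀ h0]
    exact le_max_left _ _
  | 1 =>
    rw [← norm_iteratedFDeriv_fderiv, norm_iteratedFDeriv_zero, L.fderiv]
    rw [pow_one, Nat.factorial_one, Nat.cast_one, mul_one, ← div_le_iff₀ (by positivity)]
    exact le_max_right _ _
  | k + 2 =>
    have h2 : fderiv ℝ (fun x => L x) = fun _ => L := funext fun x => L.fderiv
    have h3 := hM (k + 2)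
    rw [← norm_iteratedFDeriv_fderiv, h2, iteratedFDeriv_succ_const]
    simp only [Pi.zero_apply, norm_zero]
    positivity

end FDerivBound

/-! ### Inversion in the regularity classes -/

section Inversion

variable {W H : Type*} [NormedAddCommGroup W] [NormedSpace ℂ W] [NormedAddCommGroup H]
  [NormedSpace ℂ H] [CompleteSpace W]

theorem isOpen_setOf_isInvertible {P : Type*} [TopologicalSpace P]
    {T : P → W →L[ℂ] H} (hT : Continuous T) : IsOpen {p | (T p).IsInvertible} := by
  have : {p | (T p).IsInvertible} = T ⁻¹' Set.range ((↑) : (W ≃L[ℂ] H) → W →L[ℂ] H) := rfl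
  rw [this]
  exact ContinuousLinearEquiv.isOpen.preimage hT

theorem exists_inverse_bound {P : Type*} [TopologicalSpace P] {T : P → W →L[ℂ] H}
    {K : Set P} (hT : Continuous T) (hK : IsCompact K)
    (hKT : ∀ p ∈ K, (T p).IsInvertible) :
    ∃ B : ℝ, 0 ≤ B ∧ ∀ p ∈ K, ‖(T p).inverse‖ ≤ B := by
  obtain ⟨B, hB⟩ := hK.exists_bound_of_continuousOn (f := fun p => (T p).inverse) fun p hp =>
    ((hKT p hp).contDiffAt_map_inverse (n := 0) |>.continuousAt.comp
      hT.continuousAt).continuousWithinAt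
  exact ⟨|B|, abs_nonneg B, fun p hp => (hB p hp).trans (le_abs_self B)⟩

variable {P : Type*} [NormedAddCommGroup P] [NormedSpace ℝ P] {T : P → W →L[ℂ] H} {S : Set P}

theorem ContDiffAt.clm_inverse {n : WithTop ℕ∞} {p : P} (hT : ContDiffAt ℝ n T p)
    (hp : (T p).IsInvertible) : ContDiffAt ℝ n (fun q => (T q).inverse) p :=
  (hp.contDiffAt_map_inverse.restrict_scalars ℝ).comp p hT

/-- Leibniz' rule for a product whose first factor vanishes at `p`: the highest derivative of the
second factor drops out. -/
theorem norm_iteratedFDeriv_bilinear_le_of_eq_zero {F G Z : Type*} [NormedAddCommGroup F]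
    [NormedSpace ℝ F] [NormedAddCommGroup G] [NormedSpace ℝ G] [NormedAddCommGroup Z]
    [NormedSpace ℝ Z] (b : F →ₗ[ℝ] G →ₗ[ℝ] Z) {c : ℝ} (hc : 0 ≤ c)
    (hb : ∀ x y, ‖b x y‖ ≤ c * ‖x‖ * ‖y‖) {f : P → F} {g : P → G} (hS : IsOpen S)
    (hf : ContDiff ℝ ∞ f) (hg : ContDiffOn ℝ ∞ g S) {p : P} (hp : p ∈ S) (hfp : f p = 0) (k : ℕ) :
    ‖iteratedFDeriv ℝ (k + 1) (fun q => b (f q) (g q)) p‖ ≤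
      c * ∑ i ∈ Finset.range (k + 1), ((k + 1).choose (i + 1) : ℝ) *
        ‖iteratedFDeriv ℝ (i + 1) f p‖ * ‖iteratedFDeriv ℝ (k - i) g p‖ := by
  have h2 := (b.mkContinuous₂ c hb).norm_iteratedFDerivWithin_le_of_bilinear hf.contDiffOn hg
    hS.uniqueDiffOn hp (n := k + 1) (by exact_mod_cast le_top)
  simp only [iteratedFDerivWithin_of_isOpen _ hS hp, LinearMap.mkContinuous₂_apply] at h2
  refine h2.trans (mul_le_mul (b.mkContinuous₂_norm_le hc hb) ?_
    (Finset.sum_nonneg fun i _ => by positivity) hc)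
  rw [Finset.sum_range_succ', norm_iteratedFDeriv_zero, hfp, norm_zero, mul_zero, zero_mul,
    add_zero]
  refine (Finset.sum_congr rfl fun i _ => ?_).le
  rw [Nat.add_sub_add_right]

/-- The Leibniz bound behind the Denjoy–Carleman estimates of the inverse: differentiate
`R = R(p) + R(p) (T(p) - T) R` at the point `p`, where the factor `T(p) - T` vanishes. -/
theorem norm_iteratedFDeriv_inverse_le (hT : ContDiff ℝ ∞ T) {p : P}
    (hp : (T p).IsInvertible) (k : ℕ) :
    ‖iteratedFDeriv ℝ (k + 1) (fun q => (T q).inverse) p‖ ≤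
      ‖(T p).inverse‖ * ∑ i ∈ Finset.range (k + 1), ((k + 1).choose (i + 1) : ℝ) *
        ‖iteratedFDeriv ℝ (i + 1) T p‖ * ‖iteratedFDeriv ℝ (k - i) (fun q => (T q).inverse) p‖ := by
  set R : P → H →L[ℂ] W := fun q => (T q).inverse with hR
  let S := {q | (T q).IsInvertible}
  have hS : IsOpen S := isOpen_setOf_isInvertible hT.continuous
  have hRs : ContDiffOn ℝ ∞ R S := fun q hq =>
    (hT.contDiffAt.clm_inverse hq).contDiffWithinAt
  let b : (W →L[ℂ] H) →ₗ[ℝ] (H →L[ℂ] W) →ₗ[ℝ] (H →L[ℂ] W) :=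
    LinearMap.mk₂ ℝ (fun a r => (R p).comp (a.comp r)) (fun a a' r => by ext; simp)
      (fun c a r => by ext; simp) (fun a r r' => by ext; simp) (fun c a r => by ext; simp)
  have hb : ∀ a r, ‖b a r‖ ≤ ‖R p‖ * ‖a‖ * ‖r‖ := fun a r => by
    rw [mul_assoc]
    exact ((R p).opNorm_comp_le _).trans
      (mul_le_mul_of_nonneg_left (a.opNorm_comp_le r) (norm_nonneg _))
  have hG : ContDiff ℝ ∞ fun q => T p - T q := contDiff_const.sub hT
  have hid : ∀ q ∈ S, b (T p - T q) (R q) = R q - R p := by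
    rintro q ⟨e, he⟩
    obtain ⟨e', he'⟩ := hp
    change (R p).comp ((T p - T q).comp (R q)) = _
    simp only [hR, ← he, ← he', ContinuousLinearMap.inverse_equiv]
    ext v
    simp
  have hloc : iteratedFDeriv ℝ (k + 1) R p =
      iteratedFDeriv ℝ (k + 1) (fun q => b (T p - T q) (R q)) p := by
    have h1 : (fun q => b (T p - T q) (R q)) =ᶠ[𝓝 p] fun q => R q - R p := by
      filter_upwards [hS.mem_nhds hp] with q hq
      exact hid q hq
    rw [h1.iteratedFDeriv ℝ (k + 1) |>.eq_of_nhds, fun_iteratedFDeriv_sub_apply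
      ((hRs.contDiffAt (hS.mem_nhds hp)).of_le (by exact_mod_cast le_top)) contDiffAt_const,
      iteratedFDeriv_succ_const]
    simp
  rw [hloc]
  refine (norm_iteratedFDeriv_bilinear_le_of_eq_zero b (norm_nonneg _) hb hS hG hRs hp
    (sub_self _) k).trans_eq ?_
  congr 1
  refine Finset.sum_congr rfl fun i _ => ?_
  rw [fun_iteratedFDeriv_sub_apply contDiffAt_const
    (hT.contDiffAt.of_le (by exact_mod_cast le_top)), iteratedFDeriv_succ_const,
    Pi.zero_apply, zero_sub, norm_neg]

variable {M : ℕ → ℝ} {K : Set P}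

/-- The convolution inequality for the numbers `‖D^k (T⁻¹)‖ / k!` at a point. -/
theorem convolution_inverse_le (hT : ContDiff ℝ ∞ T) {p : P}
    (hp : (T p).IsInvertible) {B C ρ : ℝ} (hB : ‖(T p).inverse‖ ≤ B) (hρ : 0 < ρ)
    (hC : ∀ k, ‖iteratedFDeriv ℝ k T p‖ ≤ C * (ρ ^ k * (k ! : ℝ) * M k)) (k : ℕ) :
    ‖iteratedFDeriv ℝ (k + 1) (fun q => (T q).inverse) p‖ / ((k + 1)! : ℝ) ≤
      (B * C) * ∑ i ∈ Finset.range (k + 1), ρ ^ (i + 1) * M (i + 1) *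
        (‖iteratedFDeriv ℝ (k - i) (fun q => (T q).inverse) p‖ / ((k - i)! : ℝ)) := by
  have hB0 : 0 ≤ B := (norm_nonneg _).trans hB
  rw [div_le_iff₀ (by positivity)]
  refine (norm_iteratedFDeriv_inverse_le hT hp k).trans ?_
  rw [mul_assoc, mul_assoc, Finset.sum_mul, Finset.mul_sum (a := C)]
  refine mul_le_mul hB (Finset.sum_le_sum fun i hi => ?_)
    (Finset.sum_nonneg fun i _ => by positivity) hB0
  have hik : i + 1 ≤ k + 1 := by have := Finset.mem_range.1 hi; omega
  have hfac : ((k + 1)! : ℝ) = (k + 1).choose (i + 1) * (i + 1)! * (k - i)! := by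
    rw [← Nat.choose_mul_factorial_mul_factorial hik, Nat.add_sub_add_right]
    push_cast
    ring
  rw [hfac]
  set r := ‖iteratedFDeriv ℝ (k - i) (fun q => (T q).inverse) p‖
  have hr : 0 ≤ r := norm_nonneg _
  have hne : ((k - i)! : ℝ) ≠ 0 := by positivity
  calc ((k + 1).choose (i + 1) : ℝ) * ‖iteratedFDeriv ℝ (i + 1) T p‖ * r
      ≤ ((k + 1).choose (i + 1) : ℝ) * (C * (ρ ^ (i + 1) * ((i + 1)! : ℝ) * M (i + 1))) * r := by
        gcongr
        exact hC (i + 1)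
    _ = _ := by field_simp

theorem FDerivBound.exists_const_nonneg {X F : Type*} [NormedAddCommGroup X] [NormedSpace ℝ X]
    [NormedAddCommGroup F] [NormedSpace ℝ F] {K : Set X} {ρ : ℝ} {f : X → F}
    (hM : ∀ k, 0 < M k) (hρ : 0 < ρ) (h : FDerivBound M K ρ f) :
    ∃ C : ℝ, 0 ≤ C ∧ ∀ x ∈ K, ∀ k : ℕ,
      ‖iteratedFDeriv ℝ k f x‖ ≤ C * (ρ ^ k * (k ! : ℝ) * M k) := by
  obtain ⟨C, hC⟩ := h
  refine ⟨|C|, abs_nonneg C, fun x hx k => (hC x hx k).trans ?_⟩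
  have := hM k
  gcongr
  exact le_abs_self C

/-- In the Roumieu case inversion may enlarge the rate. -/
theorem FDerivBound.inverse_roumieu (hM : IsWeightSequence M) (hT : ContDiff ℝ ∞ T)
    (hK : IsCompact K) (hKT : ∀ p ∈ K, (T p).IsInvertible) {ρ : ℝ} (hρ : 0 < ρ)
    (h : FDerivBound M K ρ T) :
    ∃ σ : ℝ, 0 < σ ∧ FDerivBound M K σ fun p => (T p).inverse := by
  obtain ⟨C, hC0, hC⟩ := h.exists_const_nonneg hM.pos hρ
  obtain ⟨B, hB0, hB⟩ := exists_inverse_bound hT.continuous hK hKT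
  have hM0 := hM.pos 0
  refine ⟨ρ * (1 + B * C * M 0), by positivity, B / M 0, fun p hp k => ?_⟩
  have h1 := hM.le_of_convolution (mul_nonneg hB0 hC0) hρ
    (s := fun k => ‖iteratedFDeriv ℝ k (fun q => (T q).inverse) p‖ / (k ! : ℝ))
    (by simpa using hB p hp)
    (convolution_inverse_le hT (hKT p hp) (hB p hp) hρ (hC p hp)) hB0 k
  rw [div_le_iff₀ (by positivity)] at h1
  exact h1.trans_eq (by ring)

/-- In the Beurling case every rate `σ` of the inverse comes from the rate `σ / 2` of `T`. -/
theorem FDerivBound.inverse_beurling (hM : IsWeightSequence M)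
    (hroot : Tendsto (fun k : ℕ => M k ^ ((1 : ℝ) / (k : ℝ))) atTop atTop)
    (hT : ContDiff ℝ ∞ T) (hK : IsCompact K) (hKT : ∀ p ∈ K, (T p).IsInvertible) {σ : ℝ}
    (hσ : 0 < σ) (h : FDerivBound M K (σ / 2) T) :
    FDerivBound M K σ fun p => (T p).inverse := by
  obtain ⟨C, hC0, hC⟩ := h.exists_const_nonneg hM.pos (half_pos hσ)
  obtain ⟨B, hB0, hB⟩ := exists_inverse_bound hT.continuous hK hKT
  obtain ⟨D, hD⟩ := hM.exists_le_of_convolution hroot (mul_nonneg hB0 hC0) hσ hB0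
  refine ⟨D, fun p hp k => ?_⟩
  have h1 := hD (fun k => ‖iteratedFDeriv ℝ k (fun q => (T q).inverse) p‖ / (k ! : ℝ))
    (by simpa using hB p hp)
    (convolution_inverse_le hT (hKT p hp) (hB p hp) (half_pos hσ) (hC p hp)) k
  rw [div_le_iff₀ (by positivity)] at h1
  exact h1.trans_eq (by ring)

end Inversion

section Pencil

variable {W H : Type*} [NormedAddCommGroup W] [NormedSpace ℂ W] [NormedAddCommGroup H]
  [NormedSpace ℂ H] {X : Type*} [NormedAddCommGroup X] [NormedSpace ℝ X]

/-- The pencil `(x, z) ↦ f(x) - z j` of operators, for a fixed operator `j`. -/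
def pencil (f : X → W →L[ℂ] H) (j : W →L[ℂ] H) (p : X × ℂ) : W →L[ℂ] H := f p.1 - p.2 • j

variable {f : X → W →L[ℂ] H} {j : W →L[ℂ] H}

/-- The linear part `(x, z) ↦ z j` of the pencil. -/
noncomputable def scalarPart (X : Type*) [NormedAddCommGroup X] [NormedSpace ℝ X]
    (j : W →L[ℂ] H) : X × ℂ →L[ℝ] (W →L[ℂ] H) :=
  ((ContinuousLinearMap.toSpanSingleton ℂ j).restrictScalars ℝ).comp
    (ContinuousLinearMap.snd ℝ X ℂ)

theorem contDiff_pencil {n : WithTop ℕ∞} (hf : ContDiff ℝ n f) : ContDiff ℝ n (pencil f j) :=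
  (hf.comp contDiff_fst).sub (scalarPart X j).contDiff

theorem holderClassAt_pencil {k : ℕ} {α : ℝ≥0} (hα : α ≤ 1) (hk : ContDiff ℝ k f)
    (hf : ∀ x, HolderClassAt k α f x) (p : X × ℂ) : HolderClassAt k α (pencil f j) p :=
  by
  have h1 := HolderClassAt.comp_clm (ContinuousLinearMap.fst ℝ X ℂ) (y := p) hk (hf p.1)
  have h2 : HolderClassAt k α (scalarPart X j) p :=
    ContDiffAt.holderClassAt (scalarPart X j).contDiff.contDiffAt hα
  exact HolderClassAt.sub h1 h2

theorem fderivBound_pencil {M : ℕ → ℝ} (hM : ∀ k, 0 < M k) {ρ : ℝ} (hρ : 0 < ρ)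
    {K : Set (X × ℂ)} (hK : IsCompact K) (hf : ContDiff ℝ ∞ f)
    (h : FDerivBound M (Prod.fst '' K) ρ f) : FDerivBound M K ρ (pencil f j) := by
  have h1 : FDerivBound M K ρ fun p => f (ContinuousLinearMap.fst ℝ X ℂ p) :=
    h.comp_clm (ContinuousLinearMap.fst ℝ X ℂ) (ContinuousLinearMap.norm_fst_le ℝ X ℂ) hf
  have h2 : FDerivBound M K ρ (scalarPart X j) := FDerivBound.of_clm hM hρ hK _
  exact FDerivBound.sub (hf.comp contDiff_fst) (scalarPart X j).contDiff h1 h2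

end Pencil

/-! ### The spectrum of a compact operator is countable -/

section CompactSpectrum

variable {Y : Type*} [NormedAddCommGroup Y] [NormedSpace ℂ Y]

/-- A compact operator has only finitely many eigenvalues outside a neighbourhood of zero. -/
theorem IsCompactOperator.finite_hasEigenvalue {T : Y →L[ℂ] Y} (hT : IsCompactOperator T) {ε : ℝ}
    (hε : 0 < ε) : {μ : ℂ | Module.End.HasEigenvalue (T : Module.End ℂ Y) μ ∧ ε ≤ ‖μ‖}.Finite := by
  by_contra hinf
  let emb := Set.Infinite.natEmbedding _ hinf
  let μ : ℕ → ℂ := fun n => emb n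
  have hμinj : Function.Injective μ := fun a b hab => emb.injective (Subtype.ext hab)
  have hμε : ∀ n, ε ≤ ‖μ n‖ := fun n => (emb n).2.2
  have hμ0 : ∀ n, μ n ≠ 0 := fun n => norm_pos_iff.1 (hε.trans_le (hμε n))
  choose v hv using fun n => (emb n).2.1.exists_hasEigenvector
  have hTv : ∀ n, T (v n) = μ n • v n := fun n => (hv n).apply_eq_smul
  have hli : LinearIndependent ℂ v :=
    Module.End.eigenvectors_linearIndependent' (T : Module.End ℂ Y) μ hμinj v hv
  let F : ℕ → Submodule ℂ Y := fun n => Submodule.span ℂ (v '' Set.Iio n)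
  have hFmono : Monotone F := fun a b hab =>
    Submodule.span_mono (Set.image_mono (Set.Iio_subset_Iio hab))
  have hvF : ∀ i n, i < n → v i ∈ F n := fun i n h =>
    Submodule.subset_span (Set.mem_image_of_mem v h)
  have hvn : ∀ n, v n ∉ F n := fun n => hli.notMem_span_image (by simp)
  have hTF : ∀ n y, y ∈ F n → T y ∈ F n := by
    intro n
    change F n ≤ (F n).comap (T : Y →ₗ[ℂ] Y)
    refine Submodule.span_le.2 ?_
    rintro _ ⟨i, hi, rfl⟩
    change T (v i) ∈ F n
    rw [hTv]
    exact (F n).smul_mem _ (hvF i n hi)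
  -- `T - μ n` maps `F (n + 1)` into `F n`
  have hshift : ∀ n y, y ∈ F (n + 1) → T y - μ n • y ∈ F n := by
    intro n
    change F (n + 1) ≤ (F n).comap ((T : Y →ₗ[ℂ] Y) - μ n • LinearMap.id)
    refine Submodule.span_le.2 ?_
    rintro _ ⟨i, hi, rfl⟩
    change T (v i) - μ n • v i ∈ F n
    rw [hTv, ← sub_smul]
    rcases (Nat.lt_succ_iff_lt_or_eq.1 hi) with h | h
    · exact (F n).smul_mem _ (hvF i n h)
    · rw [h, sub_self, zero_smul]
      exact (F n).zero_mem
  -- unit vectors of `F (n + 1)` at distance at least `1 / 2` from `F n`; their rescaled images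
  -- `t n` stay in a compact set but keep a mutual distance `1 / 2`
  have hriesz : ∀ n, ∃ y ∈ F (n + 1), ‖y‖ = 1 ∧ ∀ w ∈ F n, (1 / 2 : ℝ) ≤ ‖y - w‖ := by
    intro n
    have : FiniteDimensional ℂ (F n) :=
      FiniteDimensional.span_of_finite ℂ ((Set.finite_Iio n).image v)
    have hcl : IsClosed (((F n).submoduleOf (F (n + 1)) : Submodule ℂ (F (n + 1))) :
        Set (F (n + 1))) := (F n).closed_of_finiteDimensional.preimage continuous_subtype_val
    obtain ⟨y, -, hy1, hy⟩ := riesz_lemma_of_lt_one hcl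
      ⟨⟨v n, hvF n _ n.lt_succ_self⟩, fun h => hvn n h⟩ (by norm_num : (1 / 2 : ℝ) < 1)
    exact ⟨y, y.2, hy1, fun w hw => hy ⟨w, hFmono n.le_succ hw⟩ hw⟩
  choose y hyF hy1 hyd using hriesz
  let t : ℕ → Y := fun n => T ((μ n)⁻¹ • y n)
  have hsep : ∀ m n, m < n → (1 / 2 : ℝ) ≤ ‖t n - t m‖ := by
    intro m n hmn
    have h1 : t m ∈ F n := hFmono hmn (hTF _ _ ((F (m + 1)).smul_mem _ (hyF m)))
    have h2 : t n - y n ∈ F n := by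
      have : t n - y n = (μ n)⁻¹ • (T (y n) - μ n • y n) := by
        simp only [t, map_smul, smul_sub, inv_smul_smul₀ (hμ0 n)]
      rw [this]
      exact (F n).smul_mem _ (hshift n _ (hyF n))
    have h3 := hyd n (t m - (t n - y n)) ((F n).sub_mem h1 h2)
    rwa [show y n - (t m - (t n - y n)) = t n - t m by abel] at h3
  have hmem : ∀ n, t n ∈ closure (T '' Metric.closedBall 0 ε⁻¹) := fun n =>
    subset_closure ⟨_, by
      rw [mem_closedBall_zero_iff, norm_smul, hy1, mul_one, norm_inv]
      exact inv_anti₀ hε (hμε n), rfl⟩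
  obtain ⟨a, -, idx, hidx, hlim⟩ :=
    (hT.isCompact_closure_image_closedBall ε⁻¹).tendsto_subseq hmem
  obtain ⟨N, hN⟩ := Metric.cauchySeq_iff.1 hlim.cauchySeq (1 / 2) (by norm_num)
  have h1 := hN (N + 1) N.le_succ N le_rfl
  rw [dist_eq_norm] at h1
  exact absurd (hsep _ _ (hidx N.lt_succ_self)) (not_le.2 h1)

theorem IsCompactOperator.countable_spectrum [CompleteSpace Y] {T : Y →L[ℂ] Y}
    (hT : IsCompactOperator T) : (spectrum ℂ T).Countable := by
  have hsub : spectrum ℂ T ⊆ {0} ∪ ⋃ n : ℕ, {μ : ℂ |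
      Module.End.HasEigenvalue (T : Module.End ℂ Y) μ ∧ ((n : ℝ) + 1)⁻¹ ≤ ‖μ‖} := by
    intro μ hμ
    by_cases h0 : μ = 0
    · exact Or.inl h0
    · refine Or.inr (Set.mem_iUnion.2 ?_)
      obtain ⟨n, hn⟩ := exists_nat_one_div_lt (norm_pos_iff.2 h0)
      rw [one_div] at hn
      exact ⟨n, (hT.hasEigenvalue_iff_mem_spectrum h0).2 hμ, hn.le⟩
  refine Set.Countable.mono hsub ((Set.countable_singleton 0).union
    (Set.countable_iUnion fun n => (hT.finite_hasEigenvalue (by positivity)).countable))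

end CompactSpectrum

/-! ### Closed operators with a common domain -/

section CommonDomain

variable {H : Type*} [NormedAddCommGroup H] [InnerProductSpace ℂ H]
  {V : Submodule ℂ H}

/-- Given closed operators `A x` with common domain `V`, the space `V` carries the structure of a
Banach space (the graph of one of the operators) for which the inclusion into `H` and, by the closed
graph theorem, all operators `A x` are bounded. -/
theorem exists_bounded_model [CompleteSpace H] {E : Type*} [Nonempty E] (A : E → V →ₗ[ℂ] H)
    (hA : ∀ x, (LinearPMap.mk V (A x)).IsClosed) :
    ∃ (W : Submodule ℂ (H × H)) (_ : CompleteSpace W) (e : V ≃ₗ[ℂ] W) (j : W →L[ℂ] H)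
      (f : E → W →L[ℂ] H), (∀ u, j (e u) = u) ∧ ∀ x u, f x (e u) = A x u := by
  obtain ⟨x₀⟩ := ‹Nonempty E›
  have hinj : Function.Injective (V.subtype.prod (A x₀)) := fun a b hab =>
    Subtype.ext (congrArg Prod.fst hab)
  let W := LinearMap.range (V.subtype.prod (A x₀))
  let e : V ≃ₗ[ℂ] W := LinearEquiv.ofInjective _ hinj
  have he : ∀ u, ((e u : H × H)).1 = u := fun u => rfl
  have hWcl : IsClosed (W : Set (H × H)) := by
    have h1 := hA x₀
    rw [LinearPMap.IsClosed] at h1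
    convert h1
    ext p
    rw [LinearPMap.mem_graph_iff, LinearMap.mem_range]
    exact exists_congr fun u => Prod.ext_iff
  have hW : CompleteSpace W := hWcl.completeSpace_coe
  have hsymm : ∀ w : W, ((e.symm w : V) : H) = (w : H × H).1 := fun w => by
    rw [← he, e.apply_symm_apply]
  have hcont : ∀ x, Continuous ((A x).comp (e.symm : W →ₗ[ℂ] V)) := by
    intro x
    refine LinearMap.continuous_of_seq_closed_graph _ fun u w y hu hy => ?_
    have h1 : Tendsto (fun n => (((e.symm (u n) : V) : H), A x (e.symm (u n)))) atTop
        (𝓝 ((w : H × H).1, y)) := by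
      refine Tendsto.prodMk_nhds ?_ hy
      simp only [hsymm]
      exact ((continuous_fst.comp continuous_subtype_val).tendsto w).comp hu
    have h2 := (hA x).mem_of_tendsto h1 (Eventually.of_forall fun n =>
      (LinearPMap.mk V (A x)).mem_graph (e.symm (u n)))
    obtain ⟨v, hv1, hv2⟩ := LinearPMap.mem_graph_iff _ |>.1 h2
    have hv : v = e.symm w := Subtype.ext (hv1.trans (hsymm w).symm)
    change y = A x (e.symm w)
    rw [← hv]
    exact hv2.symm
  refine ⟨W, hW, e, (ContinuousLinearMap.fst ℂ H H).comp W.subtypeL,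
    fun x => ⟨(A x).comp (e.symm : W →ₗ[ℂ] V), hcont x⟩, he, fun x u => ?_⟩
  change A x (e.symm (e u)) = A x u
  rw [e.symm_apply_apply]

theorem IsResolventAt.unique {T : V →ₗ[ℂ] H} {z : ℂ} {R R' : H →L[ℂ] H}
    (h : IsResolventAt T z R) (h' : IsResolventAt T z R') : R = R' := by
  ext y
  obtain ⟨u, hu, rfl⟩ := h.2 y
  rw [h'.1 u, h.1 u]

theorem IsResolventAt.bijective {T : V →ₗ[ℂ] H} {z : ℂ} {R : H →L[ℂ] H}
    (h : IsResolventAt T z R) : Function.Bijective (shifted T z) := by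
  refine ⟨fun u u' huu' => Subtype.ext ?_, fun y => ?_⟩
  · rw [← h.1 u, huu', h.1 u']
  · obtain ⟨u, -, hu⟩ := h.2 y
    exact ⟨u, hu⟩

theorem IsResolventAt.resolventOp_eq {T : V →ₗ[ℂ] H} {z : ℂ} {R : H →L[ℂ] H}
    (h : IsResolventAt T z R) : resolventOp T z = R := by
  have hex : ∃ R : H →L[ℂ] H, IsResolventAt T z R := ⟨R, h⟩
  rw [resolventOp, dif_pos hex]
  exact hex.choose_spec.unique h

/-- If `T` has compact resolvent, `T - z` is bijective for all but countably many `z`: it factors as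
`(1 - (z - z₀) R) (T - z₀)` with `R = (T - z₀)⁻¹` compact. -/
theorem HasCompactResolvent.countable [CompleteSpace H] {T : V →ₗ[ℂ] H}
    (h : HasCompactResolvent T) :
    {z : ℂ | ¬ Function.Bijective (shifted T z)}.Countable := by
  obtain ⟨z₀, R, hR, hRc⟩ := h
  refine Set.Countable.mono (s₂ := {z₀} ∪ (fun μ : ℂ => z₀ + μ⁻¹) '' spectrum ℂ R) ?_
    ((Set.countable_singleton _).union (hRc.countable_spectrum.image _))
  intro z hz
  by_contra hcon
  rw [Set.mem_union, not_or] at hcon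
  obtain ⟨h0, h1⟩ := hcon
  have h0' : z - z₀ ≠ 0 := sub_ne_zero.2 h0
  have hspec : (z - z₀)⁻¹ ∉ spectrum ℂ R := fun hmem =>
    h1 ⟨_, hmem, by simp⟩
  rw [spectrum.notMem_iff] at hspec
  have hbij : Function.Bijective (algebraMap ℂ (H →L[ℂ] H) (z - z₀)⁻¹ - R) := by
    obtain ⟨U, hU⟩ := hspec
    rw [← hU]
    exact (ContinuousLinearEquiv.ofUnit U).bijective
  refine hz ?_
  have hfac : ∀ u : V, shifted T z u =
      (z - z₀) • (algebraMap ℂ (H →L[ℂ] H) (z - z₀)⁻¹ - R) (shifted T z₀ u) := by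
    intro u
    rw [sub_apply, Algebra.algebraMap_eq_smul_one, smul_apply,
      one_apply_eq_self, smul_sub, smul_inv_smul₀ h0', hR.1 u]
    simp only [shifted, LinearMap.sub_apply, LinearMap.smul_apply, Submodule.subtype_apply,
      sub_smul]
    abel
  have : (shifted T z : V → H) = (fun y => (z - z₀) • y) ∘
      (algebraMap ℂ (H →L[ℂ] H) (z - z₀)⁻¹ - R) ∘ shifted T z₀ := funext hfac
  rw [this]
  exact (MulAction.bijective₀ h0').comp (hbij.comp hR.bijective)

variable {W : Type*} [NormedAddCommGroup W] [NormedSpace ℂ W]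

/-- In the bounded model `e : V ≃ W`, the operator `T - z` becomes `f - z j`. -/
theorem shifted_eq_of_model {T : V →ₗ[ℂ] H} (e : V ≃ₗ[ℂ] W) {j f : W →L[ℂ] H}
    (hj : ∀ u, j (e u) = u) (hf : ∀ u, f (e u) = T u) (z : ℂ) (u : V) :
    shifted T z u = (f - z • j) (e u) := by
  simp [shifted, hj, hf]

theorem bijective_shifted_iff [CompleteSpace H] [CompleteSpace W] {T : V →ₗ[ℂ] H}
    (e : V ≃ₗ[ℂ] W) {j f : W →L[ℂ] H}
    (hj : ∀ u, j (e u) = u) (hf : ∀ u, f (e u) = T u) (z : ℂ) :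
    Function.Bijective (shifted T z) ↔ (f - z • j).IsInvertible := by
  have h1 : (shifted T z : V → H) = (f - z • j) ∘ e :=
    funext (shifted_eq_of_model e hj hf z)
  rw [h1, e.bijective.of_comp_iff]
  constructor
  · intro h
    exact ⟨ContinuousLinearEquiv.ofBijective (f - z • j) (LinearMap.ker_eq_bot.2 h.1)
      (LinearMap.range_eq_top.2 h.2), by ext; simp⟩
  · rintro ⟨g, hg⟩
    rw [← hg]
    exact g.bijective

theorem isResolventAt_of_model {T : V →ₗ[ℂ] H} (e : V ≃ₗ[ℂ] W) {j f : W →L[ℂ] H}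
    (hj : ∀ u, j (e u) = u) (hf : ∀ u, f (e u) = T u) {z : ℂ} (h : (f - z • j).IsInvertible) :
    IsResolventAt T z (j.comp (f - z • j).inverse) := by
  obtain ⟨g, hg⟩ := h
  rw [← hg, ContinuousLinearMap.inverse_equiv]
  have hs : ∀ u, shifted T z u = g (e u) := fun u => by
    rw [shifted_eq_of_model e hj hf, ← hg]; rfl
  refine ⟨fun u => ?_, fun y => ⟨e.symm (g.symm y), ?_, ?_⟩⟩
  · simp [hs, hj]
  · simp [← hj]
  · simp [hs]

end CommonDomain

/-! ### Connectedness -/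

/-- A set in `E × ℂ` that is open for a topology in which affine lines are continuous is connected
if its fibres over `E` are open with countable complement. -/
theorem isConnected_of_countable_compl_fiber {E : Type*} [AddCommGroup E] [Module ℝ E]
    [TopologicalSpace (E × ℂ)] (hline : ∀ p q : E × ℂ, Continuous fun s : ℝ => p + s • q)
    {S : Set (E × ℂ)} (hS : IsOpen S) (hfib : ∀ x, {z : ℂ | (x, z) ∉ S}.Countable)
    (hfibo : ∀ x, IsOpen {z : ℂ | (x, z) ∈ S}) : IsConnected S := by
  have hconn : ∀ x, IsConnected {z : ℂ | (x, z) ∈ S} := fun x => by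
    have h := (hfib x).isConnected_compl_of_one_lt_rank (by simp [Complex.rank_real_complex])
    convert h using 1
    ext z
    simp
  refine ⟨?_, isPreconnected_iff_subset_of_disjoint.2 fun U₀ V₀ hU₀ hV₀ hcov hdis => ?_⟩
  · obtain ⟨z, hz⟩ := (hconn 0).nonempty
    exact ⟨_, hz⟩
  set U := S ∩ U₀ with hUdef
  set V := S ∩ V₀ with hVdef
  have hU : IsOpen U := hS.inter hU₀
  have hV : IsOpen V := hS.inter hV₀
  have hUV : Disjoint U V := Set.disjoint_left.2 fun p hp hp' => by
    have : p ∈ S ∩ (U₀ ∩ V₀) := ⟨hp.1, hp.2, hp'.2⟩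
    rw [hdis] at this
    exact this
  have hSUV : ∀ p ∈ S, p ∈ U ∪ V := fun p hp =>
    (hcov hp).imp (fun h => ⟨hp, h⟩) (fun h => ⟨hp, h⟩)
  -- within a disc contained in the fibre, points can be joined to the centre by a segment
  have hopen : ∀ x, ∀ O O' : Set (E × ℂ), IsOpen O → IsOpen O' → Disjoint O O' → O ⊆ S →
      (∀ p ∈ S, p ∈ O ∪ O') → IsOpen {z : ℂ | (x, z) ∈ O} := by
    intro x O O' hO hO' hd hOS hcov
    refine Metric.isOpen_iff.2 fun z hz => ?_
    obtain ⟨r, hr, hball⟩ := Metric.isOpen_iff.1 (hfibo x) z (hOS hz)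
    refine ⟨r, hr, fun w hw => ?_⟩
    let γ : ℝ → E × ℂ := fun s => (x, z) + s • ((0 : E), w - z)
    have hγ : ∀ s, γ s = (x, z + s • (w - z)) := fun s => by simp [γ]
    have hpre : IsPreconnected (γ '' Set.Icc 0 1) :=
      isPreconnected_Icc.image γ (hline _ _).continuousOn
    have hsub : γ '' Set.Icc 0 1 ⊆ O ∪ O' := by
      rintro _ ⟨s, hs, rfl⟩
      refine hcov _ ?_
      rw [hγ]
      refine hball ?_
      exact (convex_ball z r).add_smul_sub_mem (Metric.mem_ball_self hr) hw hs
    have h0 : (x, z) ∈ γ '' Set.Icc 0 1 := ⟨0, by simp, by simp [hγ]⟩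
    have h1 : (x, w) ∈ γ '' Set.Icc 0 1 := ⟨1, by simp, by simp [hγ]⟩
    rcases hpre.subset_or_subset hO hO' hd hsub with h | h
    · exact h h1
    · exact absurd (h h0) (Set.disjoint_left.1 hd hz)
  have hfiber : ∀ x, (∀ z, (x, z) ∈ S → (x, z) ∈ U) ∨ (∀ z, (x, z) ∈ S → (x, z) ∈ V) := by
    intro x
    exact (hconn x).isPreconnected.subset_or_subset
      (hopen x U V hU hV hUV Set.inter_subset_left hSUV)
      (hopen x V U hV hU hUV.symm Set.inter_subset_left fun p hp => (hSUV p hp).symm)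
      (Set.disjoint_left.2 fun z hz hz' => Set.disjoint_left.1 hUV hz hz')
      (fun z hz => hSUV _ hz)
  suffices h : U = ∅ ∨ V = ∅ by
    rcases h with h | h
    · refine Or.inr fun p hp => ?_
      have := hSUV p hp
      rw [h, Set.empty_union] at this
      exact this.2
    · refine Or.inl fun p hp => ?_
      have := hSUV p hp
      rw [h, Set.union_empty] at this
      exact this.2
  by_contra hne
  rw [not_or, ← ne_eq, ← ne_eq, ← Set.nonempty_iff_ne_empty, ← Set.nonempty_iff_ne_empty] at hne
  obtain ⟨⟨⟨x₀, z₀⟩, h0⟩, ⟨x₁, z₁⟩, h1⟩ := hne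
  -- the projections of `U` and `V` to the line through `x₀` and `x₁` would disconnect it
  let γ : ℝ → E := fun s => x₀ + s • (x₁ - x₀)
  have hproj : ∀ O : Set (E × ℂ), IsOpen O → IsOpen {s : ℝ | ∃ z, (γ s, z) ∈ O} := by
    intro O hO
    have : {s : ℝ | ∃ z, (γ s, z) ∈ O} =
        ⋃ z : ℂ, (fun s : ℝ => (x₀, z) + s • (x₁ - x₀, (0 : ℂ))) ⁻¹' O := by
      ext s
      simp [γ]
    rw [this]
    exact isOpen_iUnion fun z => hO.preimage (hline _ _)
  have hcase := isPreconnected_univ.subset_or_subset (hproj U hU) (hproj V hV)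
    (Set.disjoint_left.2 fun s ⟨z, hz⟩ ⟨z', hz'⟩ => by
      rcases hfiber (γ s) with h | h
      · exact Set.disjoint_left.1 hUV (h z' hz'.1) hz'
      · exact Set.disjoint_left.1 hUV hz (h z hz.1))
    (fun s _ => by
      obtain ⟨z, hz⟩ := (hconn (γ s)).nonempty
      exact (hSUV _ hz).imp (fun h => ⟨z, h⟩) (fun h => ⟨z, h⟩))
  rcases hcase with h | h
  · obtain ⟨z, hz⟩ := h (Set.mem_univ 1)
    rw [show γ 1 = x₁ by simp [γ]] at hz
    rcases hfiber x₁ with h' | h'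
    · exact Set.disjoint_left.1 hUV (h' _ h1.1) h1
    · exact Set.disjoint_left.1 hUV hz (h' _ hz.1)
  · obtain ⟨z, hz⟩ := h (Set.mem_univ 0)
    rw [show γ 0 = x₀ by simp [γ]] at hz
    rcases hfiber x₀ with h' | h'
    · exact Set.disjoint_left.1 hUV (h' _ hz.1) hz
    · exact Set.disjoint_left.1 hUV h0 (h' _ h0.1)

/-! ### Smooth curves -/

section Curves

variable {X Y : Type*} [AddCommGroup X] [Module ℝ X] [TopologicalSpace X]
  [AddCommGroup Y] [Module ℝ Y] [TopologicalSpace Y]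

theorem IsSmoothCurve.clm_comp {c : ℝ → X} (hc : IsSmoothCurve c) (L : X →L[ℝ] Y) :
    IsSmoothCurve fun t => L (c t) := by
  obtain ⟨d, hd0, hd⟩ := hc
  refine ⟨fun k t => L (d k t), by simp [hd0], fun k t => ?_⟩
  refine ((L.continuous.tendsto _).comp (hd k t)).congr fun s => ?_
  simp

theorem isSmoothCurve_line [ContinuousAdd X] [ContinuousSMul ℝ X] (p q : X) :
    IsSmoothCurve fun s : ℝ => p + s • q := by
  refine ⟨fun k => match k with
    | 0 => fun s => p + s • q
    | 1 => fun _ => q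
    | _ + 2 => fun _ => 0, rfl, fun k t => ?_⟩
  match k with
  | 0 =>
    refine tendsto_const_nhds.congr' ?_
    filter_upwards [self_mem_nhdsWithin] with s hs
    simp only [add_smul]
    rw [show p + (t • q + s • q) - (p + t • q) = s • q by abel, inv_smul_smul₀ hs]
  | 1 => simpa using tendsto_const_nhds
  | k + 2 => simpa using tendsto_const_nhds

theorem IsSmoothCurve.contDiff {F : Type*} [NormedAddCommGroup F] [NormedSpace ℝ F] {c : ℝ → F}
    (hc : IsSmoothCurve c) : ContDiff ℝ ∞ c := by
  obtain ⟨d, rfl, hd⟩ := hc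
  have hderiv : ∀ k t, HasDerivAt (d k) (d (k + 1) t) t := fun k t =>
    hasDerivAt_iff_tendsto_slope_zero.2 (hd k t)
  have h : ∀ n k : ℕ, ContDiff ℝ n (d k) := by
    intro n
    induction n with
    | zero =>
      intro k
      rw [Nat.cast_zero, contDiff_zero]
      exact continuous_iff_continuousAt.2 fun t => (hderiv k t).continuousAt
    | succ n ih =>
      intro k
      push_cast
      refine contDiff_succ_iff_deriv.2 ⟨fun t => (hderiv k t).differentiableAt, by simp, ?_⟩
      rw [show deriv (d k) = d (k + 1) from funext fun t => (hderiv k t).deriv]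
      exact ih (k + 1)
  exact contDiff_infty.2 fun n => h n 0

theorem isOpen_cInfTopology_iff {S : Set X} :
    IsOpen[cInfTopology X] S ↔ ∀ c : ℝ → X, IsSmoothCurve c → IsOpen (c ⁻¹' S) := by
  rw [cInfTopology, isOpen_iSup_iff]
  exact ⟨fun h c hc => isOpen_coinduced.1 (h ⟨c, hc⟩), fun h c => isOpen_coinduced.2 (h c.1 c.2)⟩

theorem IsSmoothCurve.continuous_cInfTopology {c : ℝ → X} (hc : IsSmoothCurve c) :
    @Continuous ℝ X _ (cInfTopology X) c :=
  continuous_def.2 fun _ hS => isOpen_cInfTopology_iff.1 hS c hc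

end Curves

/-! ### Regularity of operator families and of their inverses -/

namespace RegularityClass

variable {ι X F : Type*} [NormedAddCommGroup X] [NormedSpace ℝ X] [NormedAddCommGroup F]
  [NormedSpace ℝ F]

theorem memOn_holder_iff {k : ℕ} {α : ℝ≥0} {b : Module.Basis ι ℝ X} {U : Set X} (hU : IsOpen U)
    {f : X → F} : (holder k α).MemOn b U f ↔ ∀ x ∈ U, HolderClassAt k α f x :=
  ⟨fun h x hx => ⟨h.1.contDiffAt (hU.mem_nhds hx), h.2 x hx⟩,
    fun h => ⟨fun x hx => (h x hx).1.contDiffWithinAt, fun x hx => (h x hx).2⟩⟩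

/-- A regularity class of maps on a finite-dimensional space, with the derivatives in the
Denjoy–Carleman bounds measured in norm. It does not depend on a choice of coordinates. -/
def NormMemOn (𝒞 : RegularityClass) (U : Set X) (f : X → F) : Prop :=
  match 𝒞 with
  | smooth => ContDiffOn ℝ ∞ f U
  | holder k α => ∀ x ∈ U, HolderClassAt k α f x
  | beurling M => ContDiffOn ℝ ∞ f U ∧
      ∀ K ⊆ U, IsCompact K → ∀ ρ : ℝ, 0 < ρ → FDerivBound M K ρ f
  | roumieu M => ContDiffOn ℝ ∞ f U ∧
      ∀ K ⊆ U, IsCompact K → ∃ ρ : ℝ, 0 < ρ ∧ FDerivBound M K ρ f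

theorem memOn_iff_normMemOn [Fintype ι] {𝒞 : RegularityClass} (h𝒞 : 𝒞.Admissible)
    (b : Module.Basis ι ℝ X) {U : Set X} (hU : IsOpen U) {f : X → F} :
    𝒞.MemOn b U f ↔ 𝒞.NormMemOn U f := by
  cases 𝒞 with
  | smooth => rfl
  | holder k α => exact memOn_holder_iff hU
  | beurling M =>
    refine and_congr_right fun _ => forall₃_congr fun K _ _ => ⟨fun h ρ hρ => ?_, fun h ρ hρ => ?_⟩
    · obtain ⟨c, hc, hcM⟩ := DenjoyCarlemanBound.exists_fderivBound (K := K) (F := F) h𝒞.1.pos b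
      have := hcM (ρ / c) (by positivity) f (h _ (by positivity))
      rwa [mul_div_cancel₀ _ hc.ne'] at this
    · obtain ⟨c, hc, hcM⟩ := FDerivBound.exists_denjoyCarlemanBound (M := M) (K := K) (f := f) b
      have := hcM (ρ / c) (h _ (by positivity))
      rwa [mul_div_cancel₀ _ hc.ne'] at this
  | roumieu M =>
    refine and_congr_right fun _ => forall₃_congr fun K _ _ => ⟨?_, ?_⟩
    · rintro ⟨ρ, hρ, h⟩
      obtain ⟨c, hc, hcM⟩ := DenjoyCarlemanBound.exists_fderivBound (K := K) (F := F) h𝒞.pos b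
      exact ⟨c * ρ, by positivity, hcM ρ hρ.le f h⟩
    · rintro ⟨ρ, hρ, h⟩
      obtain ⟨c, hc, hcM⟩ := FDerivBound.exists_denjoyCarlemanBound (M := M) (K := K) (f := f) b
      exact ⟨c * ρ, by positivity, hcM ρ h⟩

variable {𝒞 : RegularityClass}

theorem NormMemOn.congr {U : Set X} (hU : IsOpen U) {f g : X → F} (hf : 𝒞.NormMemOn U f)
    (h : ∀ x ∈ U, f x = g x) : 𝒞.NormMemOn U g := by
  have hev : ∀ x ∈ U, f =ᶠ[𝓝 x] g := fun x hx => by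
    filter_upwards [hU.mem_nhds hx] with y hy using h y hy
  have hD : ∀ (M : ℕ → ℝ) (K : Set X) (ρ : ℝ), K ⊆ U → FDerivBound M K ρ f →
      FDerivBound M K ρ g := by
    rintro M K ρ hKU ⟨C, hC⟩
    refine ⟨C, fun x hx k => ?_⟩
    rw [← ((hev x (hKU hx)).iteratedFDeriv ℝ k).eq_of_nhds]
    exact hC x hx k
  cases 𝒞 with
  | smooth => exact ContDiffOn.congr hf fun x hx => (h x hx).symm
  | holder k α => exact fun x hx => (hf x hx).congr (hev x hx)
  | beurling M =>
    exact ⟨hf.1.congr fun x hx => (h x hx).symm,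
      fun K hK hKc ρ hρ => hD _ _ _ hK (hf.2 K hK hKc ρ hρ)⟩
  | roumieu M =>
    refine ⟨hf.1.congr fun x hx => (h x hx).symm, fun K hK hKc => ?_⟩
    obtain ⟨ρ, hρ, h⟩ := hf.2 K hK hKc
    exact ⟨ρ, hρ, hD _ _ _ hK h⟩

theorem NormMemOn.clm_comp {G : Type*} [NormedAddCommGroup G] [NormedSpace ℝ G] {U : Set X}
    (hU : IsOpen U) {f : X → F} (hf : 𝒞.NormMemOn U f) (L : F →L[ℝ] G) :
    𝒞.NormMemOn U fun x => L (f x) := by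
  have hat : ContDiffOn ℝ ∞ f U → ∀ K ⊆ U, ∀ x ∈ K, ContDiffAt ℝ ∞ f x :=
    fun h K hK x hx => h.contDiffAt (hU.mem_nhds (hK hx))
  cases 𝒞 with
  | smooth => exact L.contDiff.comp_contDiffOn hf
  | holder k α => exact fun x hx => (hf x hx).clm_comp L
  | beurling M =>
    exact ⟨L.contDiff.comp_contDiffOn hf.1,
      fun K hK hKc ρ hρ => (hf.2 K hK hKc ρ hρ).clm_comp L (hat hf.1 K hK)⟩
  | roumieu M =>
    refine ⟨L.contDiff.comp_contDiffOn hf.1, fun K hK hKc => ?_⟩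
    obtain ⟨ρ, hρ, h⟩ := hf.2 K hK hKc
    exact ⟨ρ, hρ, h.clm_comp L (hat hf.1 K hK)⟩

theorem NormMemOn.continuous (h𝒞 : 𝒞.Admissible) {f : X → F} (hf : 𝒞.NormMemOn Set.univ f) :
    Continuous f := by
  cases 𝒞 with
  | smooth => exact continuousOn_univ.1 (ContDiffOn.continuousOn hf)
  | holder k α => exact continuous_iff_continuousAt.2 fun x => (hf x trivial).1.continuousAt
  | beurling M => exact continuousOn_univ.1 hf.1.continuousOn
  | roumieu M => exact continuousOn_univ.1 hf.1.continuousOn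

end RegularityClass

section Families

open RegularityClass

universe u

-- The parameter spaces are in the lowest universe, as `HolderClassAt.comp_contDiffAt` requires.
variable {X P : Type} [NormedAddCommGroup X] [NormedSpace ℝ X] [NormedAddCommGroup P]
  [NormedSpace ℝ P] {𝒞 : RegularityClass}

/-- A family of operators is of class `𝒞` as soon as its matrix coefficients are. -/
theorem normMemOn_of_matrixCoeff {W H : Type*} [NormedAddCommGroup W] [NormedSpace ℂ W]
    [NormedAddCommGroup H] [InnerProductSpace ℂ H] [CompleteSpace W] [CompleteSpace H]
    [FiniteDimensional ℝ X] (h𝒞 : 𝒞.Admissible) {f : X → W →L[ℂ] H}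
    (h : ∀ u v, 𝒞.NormMemOn Set.univ fun x => matrixCoeff u v (f x)) :
    𝒞.NormMemOn Set.univ f := by
  cases 𝒞 with
  | smooth => exact (contDiff_infty_of_matrixCoeff fun u v => contDiffOn_univ.1 (h u v)).contDiffOn
  | holder k α =>
    exact fun x _ => holderClassAt_of_matrixCoeff h𝒞.1 h𝒞.2 k (fun u v x => h u v x trivial) x
  | beurling M =>
    have hf := contDiff_infty_of_matrixCoeff fun u v => contDiffOn_univ.1 (h u v).1
    exact ⟨hf.contDiffOn, fun K hK hKc ρ hρ =>
      FDerivBound.of_matrixCoeff_beurling h𝒞.1.pos hf hρ fun u v => (h u v).2 K hK hKc ρ hρ⟩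
  | roumieu M =>
    have hf := contDiff_infty_of_matrixCoeff fun u v => contDiffOn_univ.1 (h u v).1
    exact ⟨hf.contDiffOn, fun K hK hKc =>
      FDerivBound.of_matrixCoeff_roumieu h𝒞.pos hf fun u v => (h u v).2 K hK hKc⟩

variable {W H : Type u} [NormedAddCommGroup W] [NormedSpace ℂ W] [NormedAddCommGroup H]
  [NormedSpace ℂ H]

theorem normMemOn_pencil (h𝒞 : 𝒞.Admissible) {f : X → W →L[ℂ] H} (j : W →L[ℂ] H)
    (hf : 𝒞.NormMemOn Set.univ f) : 𝒞.NormMemOn Set.univ (pencil f j) := by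
  cases 𝒞 with
  | smooth => exact (contDiff_pencil (contDiffOn_univ.1 hf)).contDiffOn
  | holder k α =>
    have hk : ContDiff ℝ k f := contDiff_iff_contDiffAt.2 fun x => (hf x trivial).1
    exact fun p _ => holderClassAt_pencil h𝒞.2 hk (fun x => hf x trivial) p
  | beurling M =>
    have hs := contDiffOn_univ.1 hf.1
    exact ⟨(contDiff_pencil hs).contDiffOn, fun K _ hKc ρ hρ =>
      fderivBound_pencil h𝒞.1.pos hρ hKc hs
        (hf.2 _ (Set.subset_univ _) (hKc.image continuous_fst) ρ hρ)⟩
  | roumieu M =>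
    have hs := contDiffOn_univ.1 hf.1
    refine ⟨(contDiff_pencil hs).contDiffOn, fun K _ hKc => ?_⟩
    obtain ⟨ρ, hρ, h⟩ := hf.2 _ (Set.subset_univ _) (hKc.image continuous_fst)
    exact ⟨ρ, hρ, fderivBound_pencil h𝒞.pos hρ hKc hs h⟩

theorem normMemOn_sub_smul (h𝒞 : 𝒞.Admissible) (h𝒞' : 𝒞.IsSmoothOrHolder) {f : X → W →L[ℂ] H}
    (j : W →L[ℂ] H) (hf : 𝒞.NormMemOn Set.univ f) {ζ : X → ℂ} (hζ : ContDiff ℝ ∞ ζ) :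
    𝒞.NormMemOn Set.univ fun x => f x - ζ x • j := by
  have hsmooth : ContDiff ℝ ∞ fun x => ζ x • j := hζ.smul contDiff_const
  cases 𝒞 with
  | smooth => exact ((contDiffOn_univ.1 hf).sub hsmooth).contDiffOn
  | holder k α =>
    intro x hx
    have h2 : HolderClassAt k α (fun x => ζ x • j) x := ContDiffAt.holderClassAt
      (hsmooth.contDiffAt.of_le (by exact_mod_cast le_top)) h𝒞.2
    exact HolderClassAt.sub (hf x hx) h2
  | beurling M => exact h𝒞'.elim
  | roumieu M => exact h𝒞'.elim

/-- The regularity classes are stable under inversion of operators. -/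
theorem normMemOn_inverse [CompleteSpace W] (h𝒞 : 𝒞.Admissible) {T : P → W →L[ℂ] H}
    (hT : 𝒞.NormMemOn Set.univ T) :
    𝒞.NormMemOn {p | (T p).IsInvertible} fun p => (T p).inverse := by
  have hsmooth : ContDiff ℝ ∞ T →
      ContDiffOn ℝ ∞ (fun p => (T p).inverse) {p | (T p).IsInvertible} :=
    fun h p hp => (h.contDiffAt.clm_inverse hp).contDiffWithinAt
  cases 𝒞 with
  | smooth => exact hsmooth (contDiffOn_univ.1 hT)
  | holder k α =>
    intro p hp
    exact HolderClassAt.comp_contDiffAt h𝒞.1 h𝒞.2 k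
      (hp.contDiffAt_map_inverse.restrict_scalars ℝ) (hT p trivial)
  | beurling M =>
    have hs := contDiffOn_univ.1 hT.1
    exact ⟨hsmooth hs, fun K hK hKc ρ hρ => FDerivBound.inverse_beurling h𝒞.1 h𝒞.2 hs hKc
      (fun p hp => hK hp) hρ (hT.2 K (Set.subset_univ K) hKc _ (half_pos hρ))⟩
  | roumieu M =>
    have hs := contDiffOn_univ.1 hT.1
    refine ⟨hsmooth hs, fun K hK hKc => ?_⟩
    obtain ⟨ρ, hρ, h⟩ := hT.2 K (Set.subset_univ K) hKc
    exact FDerivBound.inverse_roumieu h𝒞 hs hKc (fun p hp => hK hp) hρ h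

/-- On the set of invertibility, `p ↦ j T(p)⁻¹` is of class `𝒞`. -/
theorem normMemOn_comp_inverse [CompleteSpace W] (h𝒞 : 𝒞.Admissible) {T : P → W →L[ℂ] H}
    (j : W →L[ℂ] H)
    (hT : 𝒞.NormMemOn Set.univ T) :
    𝒞.NormMemOn {p | (T p).IsInvertible} fun p => j.comp (T p).inverse :=
  (normMemOn_inverse h𝒞 hT).clm_comp (isOpen_setOf_isInvertible (hT.continuous h𝒞))
    ((ContinuousLinearMap.compL ℂ H W H j).restrictScalars ℝ)

end Families

/-! ### Resolvents of families with a common domain -/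

section Resolvent

variable {H : Type*} [NormedAddCommGroup H] [InnerProductSpace ℂ H]
  {V : Submodule ℂ H} {W : Type*} [NormedAddCommGroup W] [NormedSpace ℂ W]
  {E : Type*} {A : E → V →ₗ[ℂ] H} {e : V ≃ₗ[ℂ] W} {j : W →L[ℂ] H} {f : E → W →L[ℂ] H}

/-- The matrix coefficients of the bounded model are those of the given family. -/
theorem matrixCoeff_model (hf : ∀ x u, f x (e u) = A x u) (w : W) (v : H) :
    (fun x => matrixCoeff w v (f x)) = fun x => inner ℂ v (A x (e.symm w)) := by
  funext x
  rw [matrixCoeff_apply, ← hf, e.apply_symm_apply]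

variable [CompleteSpace H] [CompleteSpace W]

theorem mem_globalResolventSet_iff (hj : ∀ u, j (e u) = u) (hf : ∀ x u, f x (e u) = A x u)
    (p : E × ℂ) : p ∈ globalResolventSet A ↔ (f p.1 - p.2 • j).IsInvertible :=
  bijective_shifted_iff e hj (hf p.1) p.2

theorem resolventOp_eq_of_mem (hj : ∀ u, j (e u) = u) (hf : ∀ x u, f x (e u) = A x u)
    {p : E × ℂ} (hp : p ∈ globalResolventSet A) :
    resolventOp (A p.1) p.2 = j.comp (f p.1 - p.2 • j).inverse :=
  (isResolventAt_of_model e hj (hf p.1)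
    ((mem_globalResolventSet_iff hj hf p).1 hp)).resolventOp_eq

theorem isResolventAt_resolventOp (hj : ∀ u, j (e u) = u) (hf : ∀ x u, f x (e u) = A x u)
    {p : E × ℂ} (hp : p ∈ globalResolventSet A) :
    IsResolventAt (A p.1) p.2 (resolventOp (A p.1) p.2) := by
  rw [resolventOp_eq_of_mem hj hf hp]
  exact isResolventAt_of_model e hj (hf p.1) ((mem_globalResolventSet_iff hj hf p).1 hp)

theorem isOpen_globalResolventSet_fiber (hj : ∀ u, j (e u) = u)
    (hf : ∀ x u, f x (e u) = A x u) (x : E) : IsOpen {z : ℂ | (x, z) ∈ globalResolventSet A} := by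
  simp only [mem_globalResolventSet_iff hj hf]
  exact isOpen_setOf_isInvertible (T := fun z : ℂ => f x - z • j) (by fun_prop)

end Resolvent

theorem lemma7p1 {H : Type*} [NormedAddCommGroup H] [InnerProductSpace ℂ H] [CompleteSpace H]
    (V : Submodule ℂ H) (𝒞 : RegularityClass) (h𝒞 : 𝒞.Admissible) :
    -- parameters in `ℝⁿ`
    (∀ (n : ℕ) (A : EuclideanSpace ℝ (Fin n) → V →ₗ[ℂ] H),
      (∀ x, IsUnboundedNormal (LinearPMap.mk V (A x))) →
      (∀ (u : V) (v : H), 𝒞.MemOn (EuclideanSpace.basisFun (Fin n) ℝ).toBasis Set.univ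
        fun x => inner ℂ v (A x u)) →
      IsOpen (globalResolventSet A) ∧
      (∀ p ∈ globalResolventSet A, IsResolventAt (A p.1) p.2 (resolventOp (A p.1) p.2)) ∧
      𝒞.MemOn ((EuclideanSpace.basisFun (Fin n) ℝ).toBasis.prod Complex.basisOneI)
        (globalResolventSet A) (fun p => resolventOp (A p.1) p.2) ∧
      ((∀ x, HasCompactResolvent (A x)) → IsConnected (globalResolventSet A))) ∧
    -- parameters in a convenient vector space
    (𝒞.IsSmoothOrHolder → ∀ (E : Type*) [AddCommGroup E] [Module ℝ E] [TopologicalSpace E]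
      [IsTopologicalAddGroup E] [ContinuousSMul ℝ E] [LocallyConvexSpace ℝ E] [T2Space E],
      IsConvenient E → ∀ A : E → V →ₗ[ℂ] H,
      (∀ x, IsUnboundedNormal (LinearPMap.mk V (A x))) →
      (∀ (u : V) (v : H), 𝒞.MemOnCurves Set.univ fun x => inner ℂ v (A x u)) →
      IsOpen[cInfTopology (E × ℂ)] (globalResolventSet A) ∧
      (∀ p ∈ globalResolventSet A, IsResolventAt (A p.1) p.2 (resolventOp (A p.1) p.2)) ∧
      𝒞.MemOnCurves (globalResolventSet A) (fun p => resolventOp (A p.1) p.2) ∧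
      ((∀ x, HasCompactResolvent (A x)) →
        @IsConnected (E × ℂ) (cInfTopology (E × ℂ)) (globalResolventSet A))) := by
  refine ⟨fun n A hA hreg => ?_, fun h𝒞' E _ _ _ _ _ _ _ _ A hA hreg => ?_⟩
  · obtain ⟨W, _, e, j, f, hj, hf⟩ := exists_bounded_model A fun x => (hA x).closed
    have hS : globalResolventSet A = {p | (pencil f j p).IsInvertible} :=
      Set.ext (mem_globalResolventSet_iff hj hf)
    have hfreg : 𝒞.NormMemOn Set.univ f := normMemOn_of_matrixCoeff h𝒞 fun w v => by
      rw [matrixCoeff_model hf]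
      exact (RegularityClass.memOn_iff_normMemOn h𝒞 _ isOpen_univ).1 (hreg _ v)
    have hpencil := normMemOn_pencil h𝒞 j hfreg
    have hopen : IsOpen (globalResolventSet A) :=
      hS ▸ isOpen_setOf_isInvertible (hpencil.continuous h𝒞)
    refine ⟨hopen, fun p hp => isResolventAt_resolventOp hj hf hp, ?_, fun hc => ?_⟩
    · refine (RegularityClass.memOn_iff_normMemOn h𝒞 _ hopen).2 ?_
      have h1 := normMemOn_comp_inverse h𝒞 j hpencil
      rw [← hS] at h1
      exact h1.congr hopen fun p hp => (resolventOp_eq_of_mem hj hf hp).symm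
    · exact isConnected_of_countable_compl_fiber (fun p q => by fun_prop) hopen
        (fun x => (hc x).countable) (isOpen_globalResolventSet_fiber hj hf)
  · obtain ⟨W, _, e, j, f, hj, hf⟩ := exists_bounded_model A fun x => (hA x).closed
    have hcurve : ∀ c : ℝ → E × ℂ, IsSmoothCurve c →
        𝒞.NormMemOn Set.univ fun t => f (c t).1 - (c t).2 • j := by
      intro c hc
      have h1 : IsSmoothCurve fun t => (c t).1 := hc.clm_comp (ContinuousLinearMap.fst ℝ E ℂ)
      have h2 : IsSmoothCurve fun t => (c t).2 := hc.clm_comp (ContinuousLinearMap.snd ℝ E ℂ)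
      refine normMemOn_sub_smul h𝒞 h𝒞' j ?_ h2.contDiff
      refine normMemOn_of_matrixCoeff h𝒞 fun w v => ?_
      have h3 := hreg (e.symm w) v _ h1 fun _ => Set.mem_univ _
      rw [← matrixCoeff_model hf] at h3
      exact (RegularityClass.memOn_iff_normMemOn h𝒞 _ isOpen_univ).1 h3
    have hopen : IsOpen[cInfTopology (E × ℂ)] (globalResolventSet A) := by
      refine isOpen_cInfTopology_iff.2 fun c hc => ?_
      have h1 : c ⁻¹' globalResolventSet A = {t | (f (c t).1 - (c t).2 • j).IsInvertible} :=
        Set.ext fun t => mem_globalResolventSet_iff hj hf (c t)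
      rw [h1]
      exact isOpen_setOf_isInvertible ((hcurve c hc).continuous h𝒞)
    refine ⟨hopen, fun p hp => isResolventAt_resolventOp hj hf hp, fun c hc hcS => ?_, fun hc => ?_⟩
    · refine (RegularityClass.memOn_iff_normMemOn h𝒞 _ isOpen_univ).2 ?_
      have h1 := normMemOn_comp_inverse h𝒞 j (hcurve c hc)
      rw [show {t | (f (c t).1 - (c t).2 • j).IsInvertible} = Set.univ from
        Set.eq_univ_of_forall fun t => (mem_globalResolventSet_iff hj hf (c t)).1 (hcS t)] at h1
      exact h1.congr isOpen_univ fun t _ => (resolventOp_eq_of_mem hj hf (hcS t)).symm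
    · exact @isConnected_of_countable_compl_fiber E _ _ (cInfTopology (E × ℂ))
        (fun p q => (isSmoothCurve_line p q).continuous_cInfTopology) _ hopen
        (fun x => (hc x).countable) (isOpen_globalResolventSet_fiber hj hf)
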